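/- \textbf{Theorem (convergence rate of the functional ridge estimator, FRE).} \emph{Model.} Let $\langle f,g\rangle=\int_0^1 fg$ and let $\|\cdot\|$ be the $L^2[0,1]$ norm. Fix $p$, and for $i=1,2,\dots$ let \[ y_i=\sum_{j=1}^p\langle z_{ij},\beta_j\rangle+\varepsilon_i , \] where the predictor vectors $(z_{i1},\dots,z_{ip})$ are identically distributed, have continuous sample paths on $[0,1]$ and satisfy $\sup_t|z_{ij}(t)|\le C_1$ almost surely with a constant $C_1$. The squared prediction norm is $\|f\|_2^2=E\big[(\sum_j\langle f_j,z_{1j}\rangle)^2\big]=\langle f,\Gamma f\rangle$, where $\Gamma$ is the covariance operator of the predictor vector. \emph{Smoothness, penalty and splines.} Let $s=s'+\nu$ with $s'\in\mathbb N$, $\nu\in[0,1]$. Each $\beta_j$ has $s'$ continuous derivatives on $[0,1]$, and $\beta_j^{(s')}$ is Hölder with exponent $\nu$. Let $m\ge1$ be an integer with $m\le s$, and let $q\ge s$ be an integer. For each $n$ let $\mathcal S_n$ be the space of splines of degree $q$ on $[0,1]$ with $k_n\ge1$ equal knot intervals, spanned by the $K_z=k_n+q$ B-splines, and let $\psi_1,\dots,\psi_{K_z}$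 be a basis of $\mathcal S_n$. The basis (which depends on $n$) is normalized so that, for some $\kappa>0$ not depending on $n$, \[ \Big\|\sum_k a_k\psi_k\Big\|^2\ge\kappa K_z^{-2s}\sum_k a_k^2\qquad\text{for all }a\in\mathbb R^{K_z}; \] orthonormal bases and the standard B-spline basis have this property. \emph{Design.} For each $n$ the predictors $z_{ij}$, $i\le n$, are represented by splines $\hat z_{ij}=\sum_k c_{ijk}\psi_k$ with measurable random coefficients (obtained for instance by exact $L^2$ projection, or by pre-smoothing values on a grid) such that, almost surely, $|\langle\hat z_{ij}-z_{ij},f\rangle|\le\delta_n\|f\|$ for all $f\in\mathcal S_n$, with deterministic $\delta_n=O(K_z^{-s})$. For each $n$ the triples $\big((z_{ij})_j,(c_{ijk})_{j,k},\varepsilon_i\big)$, $i\le n$, are independent. Let $\mathbf Z$ be the $n\times pK_z$ matrix whose $i$-th row is $(c_{ijk})_{j,k}$. For each $n$ and all $i\le n$, \[ E(\varepsilon_i\mid\mathbf Z)=0,\qquad \operatorname{Var}(\varepsilon_i\mid\mathbf Z)\le\sigma^2,\qquad E\varepsilon_i^4<\infty , \] with $\sigma$ not depending on $i,n$. The eigenvalues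 of $n^{-1}\mathbf Z^\top\mathbf Z$ are bounded away from zero and infinity in probability: for each $\eta>0$ there are $0<c_0\le C_0<\infty$ such that all of them lie in $[c_0,C_0]$ with probability at least $1-\eta$, for all large $n$. \emph{Estimator.} Let $\hat{\mathbf b}$ be any measurable minimizer over $\mathbf b=(b_{jk})\in\mathbb R^{pK_z}$ of \[ \sum_{i=1}^n\Big(y_i-\sum_{j=1}^p\langle\hat z_{ij},f_j\rangle\Big)^2+\lambda_1\sum_{j=1}^p\int_0^1\big(f_j^{(m)}(t)\big)^2dt,\qquad f_j=\sum_k b_{jk}\psi_k , \] and let $\hat\beta_j=\sum_k\hat b_{jk}\psi_k$ and $\hat{\boldsymbol\beta}_{\mathrm{FRE}}=(\hat\beta_1,\dots,\hat\beta_p)$. \emph{Conclusion.} If $K_z\asymp n^{1/(4s+1)}$ and $\lambda_1>0$, $\lambda_1\asymp n^{-2s/(4s+1)}$, then \[ E\big[\|\hat{\boldsymbol\beta}_{\mathrm{FRE}}-\boldsymbol\beta\|_2^2\,\big|\,\mathbf Z\big]=O_P\big(n^{-2s/(4s+1)}\big), \] where the conditional expectation is that of a $[0,\infty]$-valued random variable.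 -/

import Mathlib

open MeasureTheory ProbabilityTheory Filter Asymptotics
open scoped ENNReal

noncomputable section

namespace FunctionalRidge

/-- The cardinal B-spline of degree `q` with knots `0, 1, …, q + 1`, by the Cox–de Boor recursion. -/
def cardinalBSpline : ℕ → ℝ → ℝ
  | 0, x => if 0 ≤ x ∧ x < 1 then 1 else 0
  | q + 1, x =>
      (x * cardinalBSpline q x + ((q : ℝ) + 2 - x) * cardinalBSpline q (x - 1)) / ((q : ℝ) + 1)

/-- The `k + q` B-splines of degree `q` with equispaced knots (spacing `1 / k`) whose support
meets the interior of `[0, 1]`: for `l = 0, …, k + q - 1` the support of the `l`-th one is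
`[(l - q) / k, (l + 1) / k]`. -/
def bSpline (q k : ℕ) (l : Fin (k + q)) (t : ℝ) : ℝ :=
  cardinalBSpline q ((k : ℝ) * t - (l : ℕ) + q)

/-- The spline space of degree `q` on `[0, 1]` with `k` equal knot intervals, of dimension
`k + q`, spanned by the B-splines. -/
def splineSpace (q k : ℕ) : Submodule ℝ (ℝ → ℝ) :=
  Submodule.span ℝ (Set.range (bSpline q k))

/-- The function `∑ₖ aₖ ψₖ`. -/
def combine {K : ℕ} (ψ : Fin K → ℝ → ℝ) (a : Fin K → ℝ) (t : ℝ) : ℝ :=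
  ∑ k, a k * ψ k t

/-- The Hölder class `C^{r + ν}` on `[0, 1]`: `r` continuous derivatives, the `r`-th of which is
Hölder with exponent `ν`. -/
def HolderClass (r : ℕ) (ν : ℝ) (f : ℝ → ℝ) : Prop :=
  ContDiffOn ℝ r f (Set.Icc 0 1) ∧
    ∃ L : ℝ, ∀ x ∈ Set.Icc (0 : ℝ) 1, ∀ y ∈ Set.Icc (0 : ℝ) 1,
      |iteratedDerivWithin r f (Set.Icc 0 1) x - iteratedDerivWithin r f (Set.Icc 0 1) y|
        ≤ L * |x - y| ^ ν

/-- The regression term `∑ⱼ ⟨zⱼ, βⱼ⟩` of one observation, with the inner products of `L²[0, 1]`. -/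
def linearPredictor {p : ℕ} (z : Fin p → unitInterval → ℝ) (β : Fin p → ℝ → ℝ) : ℝ :=
  ∑ j, ∫ t : unitInterval, z j t * β j t

/-- The squared prediction norm `‖f‖₂² = ⟨f, Γ f⟩ = E[(∑ⱼ ⟨fⱼ, Zⱼ⟩)²]` induced by the
covariance operator `Γ` of the random vector of functions `Z`. -/
def predictionNormSq {Ω : Type*} [MeasurableSpace Ω] (μ : Measure Ω) {p : ℕ}
    (Z : Ω → Fin p → unitInterval → ℝ) (f : Fin p → ℝ → ℝ) : ℝ :=
  ∫ ω, (linearPredictor (Z ω) f) ^ 2 ∂μ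

/-- The design matrix: row `i` is the stacked vector of spline coefficients of the `p` predictors
of observation `i`. -/
def designMatrix {n p K : ℕ} (c : Fin n → Fin p → Fin K → ℝ) :
    Matrix (Fin n) (Fin p × Fin K) ℝ :=
  Matrix.of fun i jk => c i jk.1 jk.2

/-- The σ-algebra generated by a random design matrix. -/
abbrev designSigma {Ω : Type*} {n p K : ℕ} (c : Fin n → Ω → Fin p → Fin K → ℝ) :
    MeasurableSpace Ω :=
  MeasurableSpace.comap (fun ω i jk => designMatrix (fun i' => c i' ω) i jk)
    (inferInstance : MeasurableSpace (Fin n → Fin p × Fin K → ℝ))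

/-- The penalized sum of squares
`∑ᵢ (yᵢ - ∑ⱼ ⟨zᵢⱼ, βⱼ⟩)² + lam ∑ⱼ ∫₀¹ (βⱼ⁽ᵐ⁾)²` at `βⱼ = ∑ₖ bⱼₖ ψₖ`, where the predictors are
represented in the spline basis, `zᵢⱼ = ∑ₖ cᵢⱼₖ ψₖ`. -/
def freCriterion {n p K : ℕ} (ψ : Fin K → ℝ → ℝ) (m : ℕ) (lam : ℝ) (y : Fin n → ℝ)
    (c : Fin n → Fin p → Fin K → ℝ) (b : Fin p → Fin K → ℝ) : ℝ :=
  ∑ i, (y i - linearPredictor (fun j (t : unitInterval) => combine ψ (c i j) t)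
      (fun j => combine ψ (b j))) ^ 2
    + lam * ∑ j, ∫ t in (0 : ℝ)..1, (iteratedDeriv m (combine ψ (b j)) t) ^ 2

/-- `b` is the coefficient vector of a functional ridge estimator: it minimizes the penalized sum
of squares over all coefficient vectors. -/
def IsFRE {n p K : ℕ} (ψ : Fin K → ℝ → ℝ) (m : ℕ) (lam : ℝ) (y : Fin n → ℝ)
    (c : Fin n → Fin p → Fin K → ℝ) (b : Fin p → Fin K → ℝ) : Prop :=
  ∀ b' : Fin p → Fin K → ℝ, freCriterion ψ m lam y c b ≤ freCriterion ψ m lam y c b'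

/-- `R n = O_P(a n)` for nonnegative, possibly infinite random variables `R n`. -/
def IsBigOP {Ω : Type*} [MeasurableSpace Ω] (μ : Measure Ω) (R : ℕ → Ω → ℝ≥0∞) (a : ℕ → ℝ) :
    Prop :=
  ∀ η : ℝ, 0 < η → ∃ M : ℝ, 0 < M ∧
    ∀ᶠ n in atTop, μ {ω | ENNReal.ofReal (M * a n) < R n ω} ≤ ENNReal.ofReal η

/-- The eigenvalues of the random matrices `A n` are bounded away from zero and infinity in
probability. -/
def EigenvaluesBoundedInProbability {Ω : Type*} [MeasurableSpace Ω] (μ : Measure Ω)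
    {ι : ℕ → Type} [∀ n, Fintype (ι n)] [∀ n, DecidableEq (ι n)]
    (A : (n : ℕ) → Ω → Matrix (ι n) (ι n) ℝ) : Prop :=
  ∀ η : ℝ, 0 < η → ∃ c₀ C₀ : ℝ, 0 < c₀ ∧ ∀ᶠ n in atTop,
    μ {ω | ¬ ∀ x ∈ spectrum ℝ (A n ω), c₀ ≤ x ∧ x ≤ C₀} ≤ ENNReal.ofReal η

end FunctionalRidge

end

noncomputable section

namespace FunctionalRidge

/-! ### Cardinal B-splines -/

/-! The fitted value of a spline vector `f` at the represented predictors is `∑ cᵢⱼₖ ⟨ψₖ, fⱼ⟩`. In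
the coordinates `θ = (⟨ψₖ, fⱼ⟩)` (`stackedInner`) the regression therefore has exactly the design
matrix `Z`, and the eigenvalue hypothesis applies to `θ` without any change of basis.

Write `K` for the dimension of the spline space, and let `g` be a spline approximant of `β` with
error `O(K^(-s))` and bounded B-spline coefficients (`exists_splineSum_approx`). Comparing the
criterion at the estimator and at `g` gives the basic inequality (`sum_sq_le_of_basic_inequality`):
where the eigenvalues are at least `c₀`, `|θ|²` for the difference `estimator - g` is at most a
constant times the sum of three terms. The squared misfit, from approximating `β` and representing
`z`, is `O(K^(-2s))`. The noise `|Zᵀε|² / n²` has mean `O(K^(2s) / n)`: rows of `Z` have squared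
length at most `B = O(K^(2s))`, because the predictors are bounded and the Gram matrix is at least
`κ K^(-2s)`. The penalty of `g` over `n` is `O(lam K^(2m+2) / n)`, hence `O(lam)`, since `2m + 2 ≤
4s + 1` and `n ≍ K^(4s+1)`; a crude bound on the derivatives of `g` is enough.

It remains to return from `|θ|²` to the prediction norm (`predictionNormSq_combine_le`). Replacing
`z` by its spline representation costs `δ² ‖f‖²`, which is `O(|θ|²)` because `‖f‖² ≤ K^(2s) |θ|² /
κ` and `δ = O(K^(-s))`. What is left is a quadratic form in the mean of `ZᵀZ / n`, whereas the
hypothesis bounds the eigenvalues only in probability. The squared Frobenius distance between `ZᵀZ /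
n` and its mean has expectation at most `B² / n = O(K^(4s) / n)`, which tends to zero, so some
outcome satisfies both the eigenvalue bound and a bound on this distance. That single outcome bounds
the deterministic mean (`sum_integral_sq_le_of_measure_le_half`).

Finally the risk is integrated over the `Z`-measurable event on which the lower eigenvalue bound
holds, and Markov's inequality for the conditional expectation gives the `O_P` statement. -/

theorem cardinalBSpline_zero (x : ℝ) :
    cardinalBSpline 0 x = if 0 ≤ x ∧ x < 1 then 1 else 0 := rfl

theorem cardinalBSpline_succ (q : ℕ) (x : ℝ) :
    cardinalBSpline (q + 1) x =
      (x * cardinalBSpline q x + ((q : ℝ) + 2 - x) * cardinalBSpline q (x - 1)) / ((q : ℝ) + 1) :=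
  rfl

theorem cardinalBSpline_of_neg (q : ℕ) {x : ℝ} (hx : x < 0) : cardinalBSpline q x = 0 := by
  induction q generalizing x with
  | zero => rw [cardinalBSpline_zero, if_neg (by intro h; linarith [h.1])]
  | succ q ih => rw [cardinalBSpline_succ, ih hx, ih (by linarith)]; simp

theorem cardinalBSpline_of_ge (q : ℕ) {x : ℝ} (hx : (q : ℝ) + 1 ≤ x) :
    cardinalBSpline q x = 0 := by
  induction q generalizing x with
  | zero =>
    rw [cardinalBSpline_zero, if_neg]
    intro h
    norm_num at hx
    linarith [h.2]
  | succ q ih =>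
    push_cast at hx
    rw [cardinalBSpline_succ, ih (by linarith), ih (by linarith)]
    simp

theorem cardinalBSpline_nonneg (q : ℕ) (x : ℝ) : 0 ≤ cardinalBSpline q x := by
  induction q generalizing x with
  | zero => rw [cardinalBSpline_zero]; split_ifs <;> norm_num
  | succ q ih =>
    rcases lt_or_ge x 0 with hx | hx
    · rw [cardinalBSpline_of_neg _ hx]
    rcases le_or_gt ((q : ℝ) + 2) x with hx' | hx'
    · rw [cardinalBSpline_of_ge _ (by push_cast; linarith)]
    rw [cardinalBSpline_succ]
    have h1 := ih x
    have h2 := ih (x - 1)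
    have h3 : 0 ≤ (q : ℝ) + 2 - x := by linarith
    positivity

theorem cardinalBSpline_le (q : ℕ) (x : ℝ) : cardinalBSpline q x ≤ (q : ℝ) + 1 := by
  induction q generalizing x with
  | zero => rw [cardinalBSpline_zero]; split_ifs <;> norm_num
  | succ q ih =>
    rcases lt_or_ge x 0 with hx | hx
    · rw [cardinalBSpline_of_neg _ hx]; positivity
    rcases le_or_gt ((q : ℝ) + 2) x with hx' | hx'
    · rw [cardinalBSpline_of_ge _ (by push_cast; linarith)]; positivity
    rw [cardinalBSpline_succ, div_le_iff₀ (by positivity)]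
    have h1 := mul_le_mul_of_nonneg_left (ih x) hx
    have h2 := mul_le_mul_of_nonneg_left (ih (x - 1)) (by linarith : 0 ≤ (q : ℝ) + 2 - x)
    push_cast
    linarith

theorem abs_cardinalBSpline_le (q : ℕ) (x : ℝ) : |cardinalBSpline q x| ≤ (q : ℝ) + 1 := by
  rw [abs_of_nonneg (cardinalBSpline_nonneg q x)]
  exact cardinalBSpline_le q x

theorem sum_cardinalBSpline_zero (k : ℕ) {x : ℝ} (h0 : 0 ≤ x) (hk : x < k) :
    ∑ l ∈ Finset.range k, cardinalBSpline 0 (x - l) = 1 := by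
  have hfl : ⌊x⌋₊ < k := (Nat.floor_lt h0).2 hk
  rw [Finset.sum_eq_single ⌊x⌋₊]
  · rw [cardinalBSpline_zero, if_pos]
    exact ⟨by linarith [Nat.floor_le h0], by linarith [Nat.lt_floor_add_one x]⟩
  · intro l _ hl
    rw [cardinalBSpline_zero, if_neg]
    rintro ⟨h1, h2⟩
    apply hl
    symm
    rw [Nat.floor_eq_iff h0]
    constructor <;> linarith
  · intro h
    exact absurd (Finset.mem_range.2 hfl) h

/-- In the recursion, each degree-`q` spline receives the weights `x - l + q` and `1 - x + l` from
two neighbours, and these add up to `q + 1`. The two surplus end terms vanish by support. The right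
endpoint is excluded because the degree-zero spline is the indicator of a half-open interval. -/
theorem sum_cardinalBSpline (q k : ℕ) {x : ℝ} (h0 : 0 ≤ x) (hk : x < k) :
    ∑ l ∈ Finset.range (k + q), cardinalBSpline q (x - l + q) = 1 := by
  induction q with
  | zero => simpa using sum_cardinalBSpline_zero k h0 hk
  | succ q ih =>
    have e1 : ∑ l ∈ Finset.range (k + q + 1),
        (x - l + (q + 1)) * cardinalBSpline q (x - l + (q + 1))
        = ∑ l ∈ Finset.range (k + q), (x - l + q) * cardinalBSpline q (x - l + q) := by
      rw [Finset.sum_range_succ', cardinalBSpline_of_ge q (by push_cast; linarith)]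
      rw [mul_zero, add_zero]
      refine Finset.sum_congr rfl fun l _ => ?_
      push_cast
      ring_nf
    have e2 : ∑ l ∈ Finset.range (k + q + 1),
        (1 - x + l) * cardinalBSpline q (x - l + q)
        = ∑ l ∈ Finset.range (k + q), (1 - x + l) * cardinalBSpline q (x - l + q) := by
      rw [Finset.sum_range_succ, cardinalBSpline_of_neg q (by push_cast; linarith)]
      simp
    have hq : (q : ℝ) + 1 ≠ 0 := by positivity
    calc ∑ l ∈ Finset.range (k + (q + 1)), cardinalBSpline (q + 1) (x - l + (q + 1 : ℕ))
        = (∑ l ∈ Finset.range (k + q + 1), ((x - l + (q + 1)) *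
            cardinalBSpline q (x - l + (q + 1)) + (1 - x + l) * cardinalBSpline q (x - l + q)))
            / (q + 1) := by
          rw [Finset.sum_div]
          refine Finset.sum_congr rfl fun l _ => ?_
          rw [cardinalBSpline_succ]
          push_cast
          rw [show x - (l : ℝ) + ((q : ℝ) + 1) - 1 = x - l + q by ring,
            show (q : ℝ) + 2 - (x - l + (q + 1)) = 1 - x + l by ring]
      _ = (∑ l ∈ Finset.range (k + q), ((q : ℝ) + 1) * cardinalBSpline q (x - l + q))
            / (q + 1) := by
          rw [Finset.sum_add_distrib, e1, e2, ← Finset.sum_add_distrib]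
          congr 1
          refine Finset.sum_congr rfl fun l _ => ?_
          ring
      _ = 1 := by rw [← Finset.mul_sum, ih, mul_one, div_self hq]

theorem continuous_cardinalBSpline {q : ℕ} (hq : 1 ≤ q) : Continuous (cardinalBSpline q) := by
  induction q, hq using Nat.le_induction with
  | base =>
    have : cardinalBSpline 1 = fun x : ℝ => max 0 (min x (2 - x)) := by
      funext x
      rw [cardinalBSpline_succ, cardinalBSpline_zero, cardinalBSpline_zero]
      rcases lt_or_ge x 0 with h0 | h0
      · rw [if_neg (by intro h; linarith [h.1]), if_neg (by intro h; linarith [h.1]),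
          max_eq_left (min_le_of_left_le h0.le)]
        simp
      rcases lt_or_ge x 1 with h1 | h1
      · rw [if_pos ⟨h0, h1⟩, if_neg (by intro h; linarith [h.1]), min_eq_left (by linarith),
          max_eq_right h0]
        simp
      rcases lt_or_ge x 2 with h2 | h2
      · rw [if_neg (by intro h; linarith [h.2]), if_pos ⟨by linarith, by linarith⟩,
          min_eq_right (by linarith), max_eq_right (by linarith)]
        simp
      · rw [if_neg (by intro h; linarith [h.2]), if_neg (by intro h; linarith [h.2]),
          max_eq_left (min_le_of_right_le (by linarith))]
        simp
    rw [this]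
    fun_prop
  | succ q _ ih =>
    have : cardinalBSpline (q + 1) = fun x : ℝ =>
        (x * cardinalBSpline q x + ((q : ℝ) + 2 - x) * cardinalBSpline q (x - 1)) / ((q : ℝ) + 1) :=
      rfl
    rw [this]
    fun_prop

/-- The derivative of a cardinal B-spline, within any set on which the shifted indicator functions
`cardinalBSpline 0` have derivative zero at the point. -/
theorem hasDerivWithinAt_cardinalBSpline {s : Set ℝ} {x : ℝ}
    (h0 : ∀ j : ℕ, HasDerivWithinAt (fun y => cardinalBSpline 0 (y - j)) 0 s x) (q j : ℕ) :
    HasDerivWithinAt (fun y => cardinalBSpline (q + 1) (y - j))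
      (cardinalBSpline q (x - j) - cardinalBSpline q (x - j - 1)) s x := by
  induction q generalizing j with
  | zero =>
    have h1 := h0 j
    have h2 := h0 (j + 1)
    have hx : HasDerivWithinAt (fun y : ℝ => y - j) 1 s x := (hasDerivWithinAt_id x s).sub_const _
    have h := ((hx.mul h1).add ((hx.const_sub 2).mul h2))
    push_cast at h
    convert! h using 1
    · funext y
      simp only [cardinalBSpline_succ, Pi.add_apply, Pi.mul_apply]
      push_cast
      rw [sub_sub y (j : ℝ) 1]
      simp
    · rw [sub_sub x (j : ℝ) 1]
      ring
  | succ q ih =>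
    have h1 := ih j
    have h2 := ih (j + 1)
    have hx : HasDerivWithinAt (fun y : ℝ => y - j) 1 s x := (hasDerivWithinAt_id x s).sub_const _
    have h := ((hx.mul h1).add ((hx.const_sub ((q : ℝ) + 3)).mul h2)).div_const ((q : ℝ) + 2)
    push_cast at h
    convert! h using 1
    · funext y
      rw [cardinalBSpline_succ]
      simp only [Pi.add_apply, Pi.mul_apply]
      push_cast
      rw [sub_sub y (j : ℝ) 1]
      ring_nf
    -- The differentiated recursion agrees with the claimed derivative after the recursion is
    -- applied once more, at `x - j` and at `x - j - 1`.
    · rw [eq_div_iff (by positivity), ← sub_sub x (j : ℝ) 1, cardinalBSpline_succ,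
        cardinalBSpline_succ]
      have hq : (q : ℝ) + 1 ≠ 0 := by positivity
      field_simp
      ring

/-- The indicator of `[j, j + 1)` is constant immediately to the right of every point, including the
knots. Right derivatives thus exist everywhere, which is what the mean value inequality below
requires. -/
theorem hasDerivWithinAt_Ici_cardinalBSpline_zero (j : ℕ) (x : ℝ) :
    HasDerivWithinAt (fun y => cardinalBSpline 0 (y - j)) 0 (Set.Ici x) x := by
  refine (hasDerivWithinAt_const x (Set.Ici x) (cardinalBSpline 0 (x - j))).congr_of_eventuallyEq
    ?_ rfl
  simp only [cardinalBSpline_zero]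
  rcases lt_or_ge x j with h | h
  · have : Set.Iio (j : ℝ) ∈ nhdsWithin x (Set.Ici x) :=
      mem_nhdsWithin_of_mem_nhds (Iio_mem_nhds h)
    filter_upwards [this] with y hy
    rw [Set.mem_Iio] at hy
    rw [if_neg (by intro h; linarith [h.1]), if_neg (by intro h; linarith [h.1])]
  rcases lt_or_ge x (j + 1) with h' | h'
  · have : Set.Iio ((j : ℝ) + 1) ∈ nhdsWithin x (Set.Ici x) :=
      mem_nhdsWithin_of_mem_nhds (Iio_mem_nhds h')
    filter_upwards [this, self_mem_nhdsWithin] with y hy hy'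
    rw [Set.mem_Iio] at hy
    rw [Set.mem_Ici] at hy'
    rw [if_pos ⟨by linarith, by linarith⟩, if_pos ⟨by linarith, by linarith⟩]
  · filter_upwards [self_mem_nhdsWithin] with y hy'
    rw [Set.mem_Ici] at hy'
    rw [if_neg (by intro h; linarith [h.2]), if_neg (by intro h; linarith [h.2])]

theorem hasDerivAt_cardinalBSpline_zero (j : ℕ) {x : ℝ} (hx : ∀ i : ℤ, x ≠ i) :
    HasDerivAt (fun y => cardinalBSpline 0 (y - j)) 0 x := by
  refine (hasDerivAt_const x (cardinalBSpline 0 (x - j))).congr_of_eventuallyEq ?_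
  simp only [cardinalBSpline_zero]
  have hl : (⌊x⌋ : ℝ) < x := lt_of_le_of_ne (Int.floor_le x) (hx _).symm
  have hr : x < ⌊x⌋ + 1 := Int.lt_floor_add_one x
  filter_upwards [Ioo_mem_nhds hl hr] with y hy
  have hfl : ⌊y⌋ = ⌊x⌋ := by
    rw [Int.floor_eq_iff]
    exact ⟨hy.1.le, hy.2⟩
  have key : ∀ z : ℝ, (0 ≤ z - j ∧ z - j < 1) ↔ ⌊z⌋ = (j : ℤ) := by
    intro z
    rw [Int.floor_eq_iff]
    push_cast
    constructor <;> rintro ⟨h1, h2⟩ <;> constructor <;> linarith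
  simp only [key, hfl]

theorem hasDerivWithinAt_Ici_cardinalBSpline (q : ℕ) (x : ℝ) :
    HasDerivWithinAt (cardinalBSpline (q + 1))
      (cardinalBSpline q x - cardinalBSpline q (x - 1)) (Set.Ici x) x := by
  simpa using hasDerivWithinAt_cardinalBSpline
    (fun j => hasDerivWithinAt_Ici_cardinalBSpline_zero j x) q 0

theorem hasDerivAt_cardinalBSpline (q : ℕ) {x : ℝ} (hx : ∀ i : ℤ, x ≠ i) :
    HasDerivAt (cardinalBSpline (q + 1))
      (cardinalBSpline q x - cardinalBSpline q (x - 1)) x := by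
  have := hasDerivWithinAt_cardinalBSpline (s := Set.univ) (x := x)
    (fun j => (hasDerivAt_cardinalBSpline_zero j hx).hasDerivWithinAt) q 0
  simpa using this

/-! ### Approximation by splines -/

/-- The spline of degree `q` with `k` knot intervals and B-spline coefficients `a`. -/
def splineSum (q k : ℕ) (a : ℕ → ℝ) (t : ℝ) : ℝ :=
  ∑ l ∈ Finset.range (k + q), a l * cardinalBSpline q ((k : ℝ) * t - l + q)

theorem splineSum_add (q k : ℕ) (a b : ℕ → ℝ) (t : ℝ) :
    splineSum q k (fun l => a l + b l) t = splineSum q k a t + splineSum q k b t := by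
  simp only [splineSum, add_mul, Finset.sum_add_distrib]

theorem splineSum_mem_splineSpace (q k : ℕ) (a : ℕ → ℝ) : splineSum q k a ∈ splineSpace q k := by
  have : splineSum q k a = ∑ l : Fin (k + q), a l • bSpline q k l := by
    funext t
    simp only [splineSum, bSpline, Finset.sum_apply, Pi.smul_apply, smul_eq_mul]
    rw [Finset.sum_range]
  rw [this]
  exact Submodule.sum_mem _ fun l _ =>
    Submodule.smul_mem _ _ (Submodule.subset_span (Set.mem_range_self l))

theorem continuous_splineSum {q : ℕ} (hq : 1 ≤ q) (k : ℕ) (a : ℕ → ℝ) :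
    Continuous (splineSum q k a) := by
  have := continuous_cardinalBSpline hq
  unfold splineSum
  fun_prop

theorem continuous_of_mem_splineSpace {q k : ℕ} (hq : 1 ≤ q) {f : ℝ → ℝ}
    (hf : f ∈ splineSpace q k) : Continuous f := by
  induction hf using Submodule.span_induction with
  | mem x hx =>
    obtain ⟨l, rfl⟩ := hx
    have := continuous_cardinalBSpline hq
    unfold bSpline
    fun_prop
  | zero => exact continuous_zero
  | add x y _ _ hx hy => exact hx.add hy
  | smul c x _ hx => exact hx.const_smul c

theorem sum_cardinalBSpline_mul (q : ℕ) {k : ℕ} (hk : 0 < k) {t : ℝ} (ht : t ∈ Set.Ico (0 : ℝ) 1) :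
    ∑ l ∈ Finset.range (k + q), cardinalBSpline q ((k : ℝ) * t - l + q) = 1 := by
  have hk' : (0 : ℝ) < k := Nat.cast_pos.2 hk
  exact sum_cardinalBSpline q k (mul_nonneg hk'.le ht.1) (mul_lt_of_lt_one_right hk' ht.2)

theorem abs_splineSum_le {q k : ℕ} (hk : 0 < k) {a : ℕ → ℝ} {A : ℝ}
    (ha : ∀ l < k + q, |a l| ≤ A) {t : ℝ} (ht : t ∈ Set.Ico (0 : ℝ) 1) :
    |splineSum q k a t| ≤ A := by
  calc |splineSum q k a t|
      ≤ ∑ l ∈ Finset.range (k + q), |a l * cardinalBSpline q ((k : ℝ) * t - l + q)| :=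
        Finset.abs_sum_le_sum_abs _ _
    _ ≤ ∑ l ∈ Finset.range (k + q), A * cardinalBSpline q ((k : ℝ) * t - l + q) := by
        refine Finset.sum_le_sum fun l hl => ?_
        rw [abs_mul, abs_of_nonneg (cardinalBSpline_nonneg _ _)]
        exact mul_le_mul_of_nonneg_right (ha l (Finset.mem_range.1 hl))
          (cardinalBSpline_nonneg _ _)
    _ = A := by rw [← Finset.mul_sum, sum_cardinalBSpline_mul q hk ht, mul_one]

/-- The knots, clamped to `[0, 1]`. -/
def clampedKnot (k l : ℕ) : ℝ := min ((l : ℝ) / k) 1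

theorem clampedKnot_mem (k l : ℕ) : clampedKnot k l ∈ Set.Icc (0 : ℝ) 1 :=
  ⟨le_min (by positivity) zero_le_one, min_le_right _ _⟩

/-- The Schoenberg operator approximates a Hölder function at the rate given by its exponent. -/
theorem abs_sub_splineSum_clampedKnot_le (q : ℕ) {k : ℕ} (hk : 0 < k) {f : ℝ → ℝ} {L ν : ℝ}
    (hν : 0 ≤ ν) (hL : 0 ≤ L) (hf : ∀ x ∈ Set.Icc (0 : ℝ) 1, ∀ y ∈ Set.Icc (0 : ℝ) 1,
      |f x - f y| ≤ L * |x - y| ^ ν) {t : ℝ} (ht : t ∈ Set.Ico (0 : ℝ) 1) :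
    |f t - splineSum q k (fun l => f (clampedKnot k l)) t|
      ≤ L * (((q : ℝ) + 1) / k) ^ ν := by
  have hk' : (0 : ℝ) < k := Nat.cast_pos.2 hk
  have hone := sum_cardinalBSpline_mul q hk ht
  -- By the partition of unity, the error is a weighted average of `f t - f (knot)`; only knots
  -- within `(q + 1) / k` of `t` carry weight.
  have e : f t - splineSum q k (fun l => f (clampedKnot k l)) t
      = ∑ l ∈ Finset.range (k + q), (f t - f (clampedKnot k l)) *
          cardinalBSpline q ((k : ℝ) * t - l + q) := by
    simp only [sub_mul, Finset.sum_sub_distrib, ← Finset.mul_sum, hone, mul_one, splineSum]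
  rw [e]
  calc _ ≤ ∑ l ∈ Finset.range (k + q), |(f t - f (clampedKnot k l)) *
          cardinalBSpline q ((k : ℝ) * t - l + q)| := Finset.abs_sum_le_sum_abs _ _
    _ ≤ ∑ l ∈ Finset.range (k + q), (L * (((q : ℝ) + 1) / k) ^ ν) *
          cardinalBSpline q ((k : ℝ) * t - l + q) := by
        refine Finset.sum_le_sum fun l _ => ?_
        rw [abs_mul, abs_of_nonneg (cardinalBSpline_nonneg _ _)]
        by_cases h1 : (k : ℝ) * t - l + q < 0
        · rw [cardinalBSpline_of_neg _ h1]; simp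
        by_cases h2 : (q : ℝ) + 1 ≤ (k : ℝ) * t - l + q
        · rw [cardinalBSpline_of_ge _ h2]; simp
        push Not at h1 h2
        refine mul_le_mul_of_nonneg_right ?_ (cardinalBSpline_nonneg _ _)
        refine (hf t ⟨ht.1, ht.2.le⟩ _ (clampedKnot_mem k l)).trans ?_
        refine mul_le_mul_of_nonneg_left (Real.rpow_le_rpow (abs_nonneg _) ?_ hν) hL
        rw [clampedKnot, abs_le]
        have hq : (0 : ℝ) ≤ (q : ℝ) := Nat.cast_nonneg q
        have h3 : (l : ℝ) / k ≤ t + ((q : ℝ) + 1) / k := by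
          rw [div_le_iff₀ hk', add_mul, div_mul_cancel₀ _ hk'.ne']
          linarith
        have h4 : t ≤ (l : ℝ) / k + ((q : ℝ) + 1) / k := by
          rw [← add_div, le_div_iff₀ hk']
          linarith
        have h5 : 0 ≤ ((q : ℝ) + 1) / k := by positivity
        -- Clamping moves a knot beyond `1` back to `1`, which is still to the right of `t`, so it
        -- only brings the knot closer.
        constructor
        · linarith [min_le_left ((l : ℝ) / k) 1]
        · rcases min_choice ((l : ℝ) / k) 1 with h | h <;> rw [h] <;> linarith [ht.2]
    _ = L * (((q : ℝ) + 1) / k) ^ ν := by rw [← Finset.mul_sum, hone, mul_one]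

/-- The coefficients of an antiderivative of a spline with coefficients `b`. -/
def primitiveCoeff (k : ℕ) (b : ℕ → ℝ) (l : ℕ) : ℝ := ∑ i ∈ Finset.range l, b i / k

/-- There are at most `k + q ≤ (q + 1) k` increments, each at most `C / k`, so the bound does not
depend on `k`. -/
theorem abs_primitiveCoeff_le {q k : ℕ} (hk : 0 < k) {b : ℕ → ℝ} {C : ℝ} (hC : 0 ≤ C)
    (hb : ∀ l < k + q, |b l| ≤ C) {l : ℕ} (hl : l < k + (q + 1)) :
    |primitiveCoeff k b l| ≤ (q + 1) * C := by
  have hk' : (1 : ℝ) ≤ k := Nat.one_le_cast.2 hk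
  calc |primitiveCoeff k b l| ≤ ∑ i ∈ Finset.range l, |b i / k| := Finset.abs_sum_le_sum_abs _ _
    _ ≤ ∑ i ∈ Finset.range l, C / k := by
        refine Finset.sum_le_sum fun i hi => ?_
        rw [abs_div, Nat.abs_cast]
        have := hb i (by have := Finset.mem_range.1 hi; omega)
        gcongr
    _ = l * (C / k) := by simp
    _ ≤ ((q + 1) * k) * (C / k) := by
        have h1 : (l : ℝ) ≤ k + q := by exact_mod_cast (by omega : l ≤ k + q)
        have h2 : (k : ℝ) + q ≤ (q + 1) * k := by nlinarith [(Nat.cast_nonneg q : (0 : ℝ) ≤ q)]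
        gcongr
        linarith
    _ = (q + 1) * C := by field_simp

/-- Summation by parts: differentiation replaces coefficients by `k` times their differences, and
the differences of `primitiveCoeff` are `b l / k`. Only the right derivative is claimed, since for
`q = 0` the derivative jumps at the knots. -/
theorem hasDerivWithinAt_splineSum_primitiveCoeff (q : ℕ) {k : ℕ} (hk : 0 < k) (b : ℕ → ℝ)
    {t : ℝ} (ht : t ∈ Set.Ico (0 : ℝ) 1) :
    HasDerivWithinAt (splineSum (q + 1) k (primitiveCoeff k b)) (splineSum q k b t)
      (Set.Ici t) t := by
  have hk' : (0 : ℝ) < k := Nat.cast_pos.2 hk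
  set a := primitiveCoeff k b with ha
  set N := fun l : ℕ => cardinalBSpline q ((k : ℝ) * t - l + (q + 1)) with hN
  have hterm : ∀ l : ℕ, HasDerivWithinAt
      (fun y : ℝ => a l * cardinalBSpline (q + 1) ((k : ℝ) * y - l + ((q + 1 : ℕ) : ℝ)))
      (a l * ((N l - N (l + 1)) * k)) (Set.Ici t) t := by
    intro l
    have hin : HasDerivWithinAt (fun y : ℝ => (k : ℝ) * y - l + ((q + 1 : ℕ) : ℝ)) k
        (Set.Ici t) t := by
      simpa using! (((hasDerivWithinAt_id t (Set.Ici t)).const_mul (k : ℝ)).sub_const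
        (l : ℝ)).add_const (((q + 1 : ℕ) : ℝ))
    have hout := hasDerivWithinAt_Ici_cardinalBSpline q ((k : ℝ) * t - l + ((q + 1 : ℕ) : ℝ))
    have hcomp := hout.comp t hin (fun y hy => by
      rw [Set.mem_Ici] at hy ⊢
      have := mul_le_mul_of_nonneg_left hy hk'.le
      linarith)
    have h := hcomp.const_mul (a l)
    convert! h using 1
    simp only [hN]
    push_cast
    rw [show (k : ℝ) * t - (l + 1) + (q + 1) = k * t - l + (q + 1) - 1 by ring]
  have hsum := HasDerivWithinAt.fun_sum (u := Finset.range (k + (q + 1)))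
    fun l (_ : l ∈ Finset.range (k + (q + 1))) => hterm l
  convert! hsum using 1
  -- The boundary terms of the summation by parts vanish because these two splines have no support
  -- in `[0, 1)`.
  have h0 : N 0 = 0 := by
    simp only [hN]
    refine cardinalBSpline_of_ge q ?_
    push_cast
    linarith [mul_nonneg hk'.le ht.1]
  have hlast : N (k + q + 1) = 0 := by
    simp only [hN]
    refine cardinalBSpline_of_neg q ?_
    push_cast
    have := mul_lt_of_lt_one_right hk' ht.2
    linarith
  have e1 : ∑ l ∈ Finset.range (k + (q + 1)), a l * ((N l - N (l + 1)) * k)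
      = k * (∑ l ∈ Finset.range (k + q + 1), a l * N l
        - ∑ l ∈ Finset.range (k + q + 1), a l * N (l + 1)) := by
    rw [← Finset.sum_sub_distrib, Finset.mul_sum]
    exact Finset.sum_congr rfl fun l _ => by ring
  rw [e1, Finset.sum_range_succ', h0, Finset.sum_range_succ (fun l => a l * N (l + 1)), hlast,
    mul_zero, add_zero, mul_zero, add_zero, ← Finset.sum_sub_distrib, Finset.mul_sum, splineSum]
  refine Finset.sum_congr rfl fun l _ => ?_
  have e2 : a (l + 1) = a l + b l / k := by
    simp only [ha, primitiveCoeff, Finset.sum_range_succ]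
  have e3 : N (l + 1) = cardinalBSpline q ((k : ℝ) * t - l + q) := by
    simp only [hN]
    congr 1
    push_cast
    ring
  rw [e2, e3]
  field_simp
  ring

theorem HolderClass.continuousOn {r : ℕ} {ν : ℝ} {f : ℝ → ℝ} (hf : HolderClass r ν f) :
    ContinuousOn f (Set.Icc 0 1) :=
  hf.1.continuousOn

theorem HolderClass.exists_bound {r : ℕ} {ν : ℝ} {f : ℝ → ℝ} (hf : HolderClass r ν f) :
    ∃ M : ℝ, 0 ≤ M ∧ ∀ t ∈ Set.Icc (0 : ℝ) 1, |f t| ≤ M := by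
  obtain ⟨M, hM⟩ := isCompact_Icc.exists_bound_of_continuousOn hf.continuousOn
  exact ⟨M, (norm_nonneg _).trans (hM 0 (by simp)), hM⟩

theorem HolderClass.derivWithin {r : ℕ} {ν : ℝ} {f : ℝ → ℝ} (hf : HolderClass (r + 1) ν f) :
    HolderClass r ν (derivWithin f (Set.Icc 0 1)) := by
  obtain ⟨h1, L, h2⟩ := hf
  refine ⟨?_, L, ?_⟩
  · exact h1.derivWithin (uniqueDiffOn_Icc zero_lt_one) (by norm_cast)
  · simpa only [iteratedDerivWithin_succ'] using h2

/-- Functions in the Hölder class of order `r + ν` are approximated by splines with uniformly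
bounded B-spline coefficients at the rate `k ^ (-(r + ν))`. -/
theorem exists_splineSum_approx {r q : ℕ} {ν : ℝ} (hν : ν ∈ Set.Icc (0 : ℝ) 1)
    (hrq : (r : ℝ) + ν ≤ q) {f : ℝ → ℝ} (hf : HolderClass r ν f) :
    ∃ C : ℝ, 0 ≤ C ∧ ∀ k : ℕ, 0 < k → ∃ a : ℕ → ℝ, (∀ l < k + q, |a l| ≤ C) ∧
      ∀ t ∈ Set.Ico (0 : ℝ) 1, |f t - splineSum q k a t| ≤ C * (k : ℝ) ^ (-((r : ℝ) + ν)) := by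
  induction r generalizing q f with
  | zero =>
    obtain ⟨M, hM0, hM⟩ := hf.exists_bound
    obtain ⟨-, L, hL⟩ := hf
    simp only [iteratedDerivWithin_zero] at hL
    refine ⟨max M (|L| * ((q : ℝ) + 1) ^ ν), le_max_of_le_left hM0, fun k hk =>
      ⟨fun l => f (clampedKnot k l), fun l _ => (hM _ (clampedKnot_mem k l)).trans
        (le_max_left _ _), fun t ht => ?_⟩⟩
    have hk' : (0 : ℝ) < k := Nat.cast_pos.2 hk
    refine (abs_sub_splineSum_clampedKnot_le q hk hν.1 (abs_nonneg L) (fun x hx y hy =>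
      (hL x hx y hy).trans (mul_le_mul_of_nonneg_right (le_abs_self L) (by positivity))) ht).trans ?_
    rw [Real.div_rpow (by positivity) hk'.le, Nat.cast_zero, zero_add, Real.rpow_neg hk'.le,
      ← mul_div_assoc, div_eq_mul_inv]
    exact mul_le_mul_of_nonneg_right (le_max_right _ _) (by positivity)
  | succ r ih =>
    obtain ⟨q, rfl⟩ : ∃ q', q = q' + 1 := by
      refine ⟨q - 1, (Nat.succ_pred_eq_of_pos ?_).symm⟩
      rw [← Nat.cast_pos (α := ℝ)]
      push_cast at hrq
      linarith [hν.1, (Nat.cast_nonneg r : (0 : ℝ) ≤ r)]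
    obtain ⟨C, hC0, hC⟩ := ih (q := q) (by push_cast at hrq; linarith) hf.derivWithin
    obtain ⟨M, hM0, hM⟩ := hf.exists_bound
    have hq0 : (0 : ℝ) ≤ q := Nat.cast_nonneg q
    refine ⟨(M + 2 * ((q + 1) * C)) + C * (q + 2), by positivity, fun k hk => ?_⟩
    have hk' : (0 : ℝ) < k := Nat.cast_pos.2 hk
    obtain ⟨b, hb, hbt⟩ := hC k hk
    set a := primitiveCoeff k b with ha
    have ha' : ∀ l < k + (q + 1), |a l| ≤ (q + 1) * C := fun l hl =>
      abs_primitiveCoeff_le hk hC0 hb hl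
    set G := splineSum (q + 1) k a with hG
    have hGc : Continuous G := continuous_splineSum (by omega) k a
    have hGle : ∀ t ∈ Set.Icc (0 : ℝ) 1, |G t| ≤ (q + 1) * C := by
      intro t ht
      rw [← closure_Ico (zero_ne_one' ℝ)] at ht
      have hcl : IsClosed {t | |G t| ≤ (q + 1) * C} := isClosed_le hGc.abs continuous_const
      exact closure_minimal (fun t ht => abs_splineSum_le hk ha' ht) hcl ht
    set e := C * (k : ℝ) ^ (-((r : ℝ) + ν)) with he
    have he0 : 0 ≤ e := by positivity
    -- `G` is an antiderivative of a good approximant of `f'`, so `f - G` has right derivative at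
    -- most `e` and is `e`-Lipschitz.
    have hLip' : ∀ x ∈ Set.Icc (0 : ℝ) 1, ∀ y ∈ Set.Icc x 1,
        |(f y - G y) - (f x - G x)| ≤ e * (y - x) := by
      intro x hx
      have hsub : Set.Icc x 1 ⊆ Set.Icc (0 : ℝ) 1 := Set.Icc_subset_Icc_left hx.1
      refine norm_image_sub_le_of_norm_deriv_right_le_segment
        (f := fun t => f t - G t)
        (f' := fun t => _root_.derivWithin f (Set.Icc 0 1) t - splineSum q k b t)
        ((hf.continuousOn.mono hsub).sub hGc.continuousOn) ?_ ?_
      · intro t ht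
        have ht' : t ∈ Set.Ico (0 : ℝ) 1 := ⟨hx.1.trans ht.1, ht.2⟩
        have hd : HasDerivWithinAt f (_root_.derivWithin f (Set.Icc 0 1) t) (Set.Icc 0 1) t :=
          ((hf.1.differentiableOn (by simp)) t ⟨ht'.1, ht'.2.le⟩).hasDerivWithinAt
        refine HasDerivWithinAt.sub (hd.mono_of_mem_nhdsWithin ?_)
          (hasDerivWithinAt_splineSum_primitiveCoeff q hk b ht')
        refine mem_of_superset (Icc_mem_nhdsGE ht'.2) (Set.Icc_subset_Icc_left ht'.1)
      · intro t ht
        exact hbt t ⟨hx.1.trans ht.1, ht.2⟩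
    have hLip : ∀ x ∈ Set.Icc (0 : ℝ) 1, ∀ y ∈ Set.Icc (0 : ℝ) 1,
        |(f x - G x) - (f y - G y)| ≤ e * |x - y| ^ (1 : ℝ) := by
      intro x hx y hy
      rw [Real.rpow_one]
      rcases le_total x y with h | h
      · rw [abs_sub_comm, abs_sub_comm x y, abs_of_nonneg (sub_nonneg.2 h)]
        exact hLip' x hx y ⟨h, hy.2⟩
      · rw [abs_of_nonneg (sub_nonneg.2 h)]
        exact hLip' y hy x ⟨h, hx.2⟩
    -- Adding to `G` the Schoenberg approximant of the `e`-Lipschitz remainder `f - G` gains the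
    -- missing factor `1 / k`. It also absorbs the constant of integration.
    refine ⟨fun l => a l + (f (clampedKnot k l) - G (clampedKnot k l)), fun l hl => ?_,
      fun t ht => ?_⟩
    · have h1 := ha' l hl
      have h2 := hM _ (clampedKnot_mem k l)
      have h3 := hGle _ (clampedKnot_mem k l)
      have h4 : 0 ≤ C * (q + 2) := by positivity
      calc _ ≤ |a l| + (|f (clampedKnot k l)| + |G (clampedKnot k l)|) :=
            (abs_add_le _ _).trans (add_le_add le_rfl (abs_sub _ _))
        _ ≤ _ := by linarith
    · have h := abs_sub_splineSum_clampedKnot_le (q + 1) hk zero_le_one he0 hLip ht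
      rw [splineSum_add, ← sub_sub]
      refine h.trans ?_
      have e1 : e * ((((q + 1 : ℕ) : ℝ) + 1) / k) ^ (1 : ℝ)
          = C * (q + 2) * (k : ℝ) ^ (-(((r + 1 : ℕ) : ℝ) + ν)) := by
        rw [Real.rpow_one, he,
          show -(((r + 1 : ℕ) : ℝ) + ν) = -((r : ℝ) + ν) - 1 by push_cast; ring,
          Real.rpow_sub_one hk'.ne']
        push_cast
        ring
      rw [e1]
      refine mul_le_mul_of_nonneg_right ?_ (by positivity)
      have : 0 ≤ M + 2 * ((q + 1) * C) := by positivity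
      linarith

/-! ### Derivatives of splines -/

/-- Off the knots, the derivatives of order `m ≤ q` of a combination of scaled cardinal B-splines
of degree `q` are bounded in terms of the coefficients. -/
theorem abs_iteratedDeriv_sum_cardinalBSpline_le (k : ℕ) {m q : ℕ} (hmq : m ≤ q) {ι : Type}
    [Fintype ι] (a : ι → ℝ) (d : ι → ℤ) {t : ℝ} (ht : ∀ i : ℤ, (k : ℝ) * t ≠ i) :
    |iteratedDeriv m (fun y => ∑ i, a i * cardinalBSpline q ((k : ℝ) * y + d i)) t|
      ≤ (2 * k) ^ m * ((q + 1) * ∑ i, |a i|) := by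
  induction m generalizing q ι t with
  | zero =>
    rw [iteratedDeriv_zero, pow_zero, one_mul, Finset.mul_sum]
    refine (Finset.abs_sum_le_sum_abs _ _).trans (Finset.sum_le_sum fun i _ => ?_)
    rw [abs_mul, mul_comm]
    exact mul_le_mul_of_nonneg_right (abs_cardinalBSpline_le _ _) (abs_nonneg _)
  | succ m ih =>
    obtain ⟨q, rfl⟩ : ∃ q', q = q' + 1 := ⟨q - 1, by omega⟩
    -- The derivative of each term is a difference of two splines of lower degree. Doubling the
    -- index set keeps the form of the sum and multiplies the total size of the coefficients by `2
    -- k`.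
    set a' : ι ⊕ ι → ℝ := Sum.elim (fun i => a i * k) (fun i => -(a i * k)) with ha'
    set d' : ι ⊕ ι → ℤ := Sum.elim d (fun i => d i - 1) with hd'
    have hderiv : ∀ y : ℝ, (∀ i : ℤ, (k : ℝ) * y ≠ i) →
        deriv (fun y => ∑ i, a i * cardinalBSpline (q + 1) ((k : ℝ) * y + d i)) y
          = ∑ i, a' i * cardinalBSpline q ((k : ℝ) * y + d' i) := by
      intro y hy
      have hterm : ∀ i, HasDerivAt (fun y => a i * cardinalBSpline (q + 1) ((k : ℝ) * y + d i))
          (a i * ((cardinalBSpline q ((k : ℝ) * y + d i)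
            - cardinalBSpline q ((k : ℝ) * y + d i - 1)) * k)) y := by
        intro i
        have hin : HasDerivAt (fun y : ℝ => (k : ℝ) * y + d i) k y := by
          simpa using! ((hasDerivAt_id y).const_mul (k : ℝ)).add_const (d i : ℝ)
        refine ((hasDerivAt_cardinalBSpline q ?_).comp y hin).const_mul (a i)
        intro j hj
        apply hy (j - d i)
        push_cast
        linarith
      rw [(HasDerivAt.fun_sum fun i _ => hterm i).deriv, Fintype.sum_sum_type,
        ← Finset.sum_add_distrib]
      refine Finset.sum_congr rfl fun i _ => ?_
      simp only [ha', hd', Sum.elim_inl, Sum.elim_inr]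
      push_cast
      rw [← add_sub_assoc]
      ring
    -- The integers are closed, so the formula for the derivative holds near `t` and can be
    -- differentiated again.
    have hopen : ∀ᶠ y in nhds t, ∀ i : ℤ, (k : ℝ) * y ≠ i := by
      have hc : IsClosed (Set.range ((↑) : ℤ → ℝ)) := Int.isClosedEmbedding_coe_real.isClosed_range
      have hcont : Continuous fun y : ℝ => (k : ℝ) * y := by fun_prop
      filter_upwards [(hc.isOpen_compl.preimage hcont).mem_nhds
        (show t ∈ _ by rintro ⟨i, hi⟩; exact ht i hi.symm)] with y hy i hi
      exact hy ⟨i, hi.symm⟩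
    have heq : deriv (fun y => ∑ i, a i * cardinalBSpline (q + 1) ((k : ℝ) * y + d i))
        =ᶠ[nhds t] fun y => ∑ i, a' i * cardinalBSpline q ((k : ℝ) * y + d' i) :=
      hopen.mono hderiv
    rw [iteratedDeriv_succ', heq.iteratedDeriv_eq]
    refine (ih (by omega) a' d' ht).trans ?_
    have hsum : ∑ i, |a' i| = 2 * k * ∑ i, |a i| := by
      rw [Fintype.sum_sum_type]
      simp only [ha', Sum.elim_inl, Sum.elim_inr, abs_neg, abs_mul, Nat.abs_cast,
        ← Finset.sum_mul]
      ring
    have hpos : 0 ≤ ∑ i, |a i| := Finset.sum_nonneg fun i _ => abs_nonneg _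
    rw [hsum, pow_succ]
    push_cast
    have : (2 * (k : ℝ)) ^ m * ((q + 1) * (2 * k * ∑ i, |a i|))
        ≤ (2 * (k : ℝ)) ^ m * ((q + 1 + 1) * (2 * k * ∑ i, |a i|)) := by
      gcongr
      linarith
    refine this.trans (le_of_eq ?_)
    ring

/-- The knots are a null set, so the pointwise bound off them suffices. It uses only the size of the
coefficients; the resulting growth is affordable because the penalty is divided by `n`. -/
theorem intervalIntegral_iteratedDeriv_splineSum_sq_le {m q k : ℕ} (hmq : m ≤ q) (hk : 0 < k)
    {a : ℕ → ℝ} {A : ℝ} (ha : ∀ l < k + q, |a l| ≤ A) :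
    ∫ t in (0 : ℝ)..1, (iteratedDeriv m (splineSum q k a) t) ^ 2
      ≤ (2 ^ m * (q + 1) * A * ((k + q : ℕ) : ℝ) ^ (m + 1)) ^ 2 := by
  have hA : 0 ≤ A := (abs_nonneg _).trans (ha 0 (by omega))
  have hae : ∀ᵐ t : ℝ, ∀ i : ℤ, (k : ℝ) * t ≠ i := by
    have hk' : (k : ℝ) ≠ 0 := by positivity
    rw [ae_all_iff]
    intro i
    filter_upwards [compl_mem_ae_iff.2 (measure_singleton ((i : ℝ) / k))] with t ht h
    apply ht
    rw [Set.mem_singleton_iff, ← h]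
    field_simp
  have hsum : splineSum q k a = fun y => ∑ i : Fin (k + q),
      a i * cardinalBSpline q ((k : ℝ) * y + ((q - (i : ℕ) : ℤ) : ℝ)) := by
    funext y
    rw [splineSum, Finset.sum_range]
    refine Finset.sum_congr rfl fun i _ => ?_
    push_cast
    congr 2
    ring
  set B := 2 ^ m * (q + 1) * A * ((k + q : ℕ) : ℝ) ^ (m + 1) with hB
  have hbound : ∀ᵐ t : ℝ, ‖(iteratedDeriv m (splineSum q k a) t) ^ 2‖ ≤ B ^ 2 := by
    filter_upwards [hae] with t ht
    have h := abs_iteratedDeriv_sum_cardinalBSpline_le k hmq (fun i : Fin (k + q) => a i)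
      (fun i => (q - (i : ℕ) : ℤ)) ht
    rw [← hsum] at h
    rw [norm_pow, Real.norm_eq_abs]
    refine pow_le_pow_left₀ (abs_nonneg _) (h.trans ?_) 2
    have h1 : ∑ i : Fin (k + q), |a i| ≤ (k + q : ℕ) * A := by
      refine (Finset.sum_le_card_nsmul _ _ A fun (i : Fin (k + q)) _ => ha _ i.isLt).trans ?_
      simp
    have h2 : (k : ℝ) ≤ (k + q : ℕ) := by exact_mod_cast Nat.le_add_right k q
    calc (2 * (k : ℝ)) ^ m * ((q + 1) * ∑ i : Fin (k + q), |a i|)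
        ≤ (2 * ((k + q : ℕ) : ℝ)) ^ m * ((q + 1) * ((k + q : ℕ) * A)) := by gcongr
      _ = B := by rw [hB, mul_pow, pow_succ]; ring
  have := intervalIntegral.norm_integral_le_of_norm_le_const_ae
    (a := 0) (b := 1) (hbound.mono fun t ht _ => ht)
  simp only [sub_zero, abs_one, mul_one] at this
  exact (le_abs_self _).trans this

/-! ### Moments of sums of independent variables -/

theorem integral_sq_sum_sub_integral_le {Ω ι : Type*} [MeasurableSpace Ω] {μ : Measure Ω}
    [IsProbabilityMeasure μ] [Fintype ι] {U : ι → Ω → ℝ} (hU : ∀ i, MemLp (U i) 2 μ)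
    (hind : Pairwise fun i j => IndepFun (U i) (U j) μ) :
    ∫ ω, (∑ i, U i ω - ∑ i, ∫ ω', U i ω' ∂μ) ^ 2 ∂μ ≤ ∑ i, ∫ ω, U i ω ^ 2 ∂μ := by
  have hsum : MemLp (∑ i, U i) 2 μ := memLp_finsetSum' _ fun i _ => hU i
  have h1 : ∫ ω, (∑ i, U i ω - ∑ i, ∫ ω', U i ω' ∂μ) ^ 2 ∂μ = Var[∑ i, U i; μ] := by
    rw [variance_eq_integral hsum.aemeasurable]
    simp only [Finset.sum_apply]
    rw [integral_finsetSum _ fun i _ => (hU i).integrable one_le_two]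
  rw [h1, IndepFun.variance_sum (fun i _ => hU i) (fun i _ j _ hij => hind hij)]
  exact Finset.sum_le_sum fun i _ => variance_le_expectation_sq (hU i).aestronglyMeasurable

/-- The second moment of `Zᵀ ε` for independent rows of `Z` and errors uncorrelated with them. -/
theorem integral_sum_sq_sum_mul_le {Ω ι α : Type*} [MeasurableSpace Ω] {μ : Measure Ω}
    [IsProbabilityMeasure μ] [Fintype ι] [Fintype α] {c : ι → Ω → α → ℝ} {ε : ι → Ω → ℝ}
    {B V : ℝ} (hc : ∀ i, Measurable (c i)) (hε : ∀ i, MemLp (ε i) 2 μ)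
    (hind : iIndepFun (fun i ω => (c i ω, ε i ω)) μ)
    (hB : ∀ i, ∀ᵐ ω ∂μ, ∑ a, c i ω a ^ 2 ≤ B) (hB0 : 0 ≤ B)
    (hmean : ∀ i a, ∫ ω, c i ω a * ε i ω ∂μ = 0) (hV : ∀ i, ∫ ω, ε i ω ^ 2 ∂μ ≤ V) :
    Integrable (fun ω => ∑ a, (∑ i, c i ω a * ε i ω) ^ 2) μ ∧
      ∫ ω, ∑ a, (∑ i, c i ω a * ε i ω) ^ 2 ∂μ ≤ Fintype.card ι * (B * V) := by
  have hca : ∀ i a, Measurable fun ω => c i ω a := fun i a => (measurable_pi_apply a).comp (hc i)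
  have hbd : ∀ i a, ∀ᵐ ω ∂μ, ‖c i ω a‖ ≤ √B := by
    intro i a
    filter_upwards [hB i] with ω hω
    refine Real.abs_le_sqrt (le_trans ?_ hω)
    exact Finset.single_le_sum (f := fun a => c i ω a ^ 2) (fun a _ => sq_nonneg _)
      (Finset.mem_univ a)
  have hU : ∀ a i, MemLp (fun ω => c i ω a * ε i ω) 2 μ := fun a i =>
    MemLp.mul (p := ∞) (q := 2) (hε i)
      (memLp_top_of_bound (hca i a).aestronglyMeasurable _ (hbd i a))
  have hsumL : ∀ a, MemLp (fun ω => ∑ i, c i ω a * ε i ω) 2 μ := fun a =>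
    memLp_finsetSum _ fun i _ => hU a i
  have hpair : ∀ a, Pairwise fun i j =>
      IndepFun (fun ω => c i ω a * ε i ω) (fun ω => c j ω a * ε j ω) μ := by
    intro a i j hij
    have hm : Measurable fun x : (α → ℝ) × ℝ => x.1 a * x.2 := by fun_prop
    exact (hind.indepFun hij).comp hm hm
  refine ⟨integrable_finsetSum _ fun a _ => (hsumL a).integrable_sq, ?_⟩
  rw [integral_finsetSum _ fun a _ => (hsumL a).integrable_sq]
  calc ∑ a, ∫ ω, (∑ i, c i ω a * ε i ω) ^ 2 ∂μ
      ≤ ∑ a, ∑ i, ∫ ω, (c i ω a * ε i ω) ^ 2 ∂μ := by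
        refine Finset.sum_le_sum fun a _ => ?_
        have h := integral_sq_sum_sub_integral_le (hU a) (hpair a)
        simpa only [hmean, Finset.sum_const_zero, sub_zero] using h
    _ = ∑ i, ∫ ω, ∑ a, (c i ω a * ε i ω) ^ 2 ∂μ := by
        rw [Finset.sum_comm]
        refine Finset.sum_congr rfl fun i _ => ?_
        rw [integral_finsetSum _ fun a _ => (hU a i).integrable_sq]
    _ ≤ ∑ i : ι, B * V := by
        refine Finset.sum_le_sum fun i _ => ?_
        calc ∫ ω, ∑ a, (c i ω a * ε i ω) ^ 2 ∂μ ≤ ∫ ω, B * ε i ω ^ 2 ∂μ := by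
              refine integral_mono_ae (integrable_finsetSum _ fun a _ => (hU a i).integrable_sq)
                ((hε i).integrable_sq.const_mul B) ?_
              filter_upwards [hB i] with ω hω
              simp only [mul_pow, ← Finset.sum_mul]
              exact mul_le_mul_of_nonneg_right hω (sq_nonneg _)
          _ ≤ B * V := by
              rw [integral_const_mul]
              exact mul_le_mul_of_nonneg_left (hV i) hB0
    _ = Fintype.card ι * (B * V) := by simp

/-- If the empirical second moment matrix of independent bounded vectors is bounded above with
probability at least one half, then so is, up to an additive constant, the mean second moment
matrix. -/
theorem sum_integral_sq_le_of_measure_le_half {Ω α : Type*} [MeasurableSpace Ω] {μ : Measure Ω}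
    [IsProbabilityMeasure μ] {n : ℕ} [Fintype α] {c : Fin n → Ω → α → ℝ} {B C : ℝ}
    (hn : 0 < n) (hc : ∀ i, Measurable (c i)) (hind : iIndepFun c μ)
    (hB : ∀ i, ∀ᵐ ω ∂μ, ∑ a, c i ω a ^ 2 ≤ B) (hBn : B ^ 2 / n < 1 / 2)
    (hC : μ {ω | ¬ ∀ θ : α → ℝ, ∑ i, (∑ a, c i ω a * θ a) ^ 2 ≤ n * C * ∑ a, θ a ^ 2} ≤ 1 / 2)
    (θ : α → ℝ) :
    ∑ i, ∫ ω, (∑ a, c i ω a * θ a) ^ 2 ∂μ ≤ n * (C + 1) * ∑ a, θ a ^ 2 := by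
  have hn' : (0 : ℝ) < n := Nat.cast_pos.2 hn
  have hca : ∀ i a, Measurable fun ω => c i ω a := fun i a => (measurable_pi_apply a).comp (hc i)
  have hbd : ∀ i a, ∀ᵐ ω ∂μ, |c i ω a| ≤ √B := by
    intro i a
    filter_upwards [hB i] with ω hω
    refine Real.abs_le_sqrt (le_trans ?_ hω)
    exact Finset.single_le_sum (f := fun a => c i ω a ^ 2) (fun a _ => sq_nonneg _)
      (Finset.mem_univ a)
  have hU : ∀ (x : α × α) i, MemLp (fun ω => c i ω x.1 * c i ω x.2) 2 μ := by
    intro x i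
    refine MemLp.of_bound ((hca i x.1).mul (hca i x.2)).aestronglyMeasurable (√B * √B) ?_
    filter_upwards [hbd i x.1, hbd i x.2] with ω h1 h2
    rw [Real.norm_eq_abs, abs_mul]
    gcongr
  have hpair : ∀ x : α × α, Pairwise fun i j =>
      IndepFun (fun ω => c i ω x.1 * c i ω x.2) (fun ω => c j ω x.1 * c j ω x.2) μ := by
    intro x i j hij
    have hm : Measurable fun y : α → ℝ => y x.1 * y x.2 := by fun_prop
    exact (hind.indepFun hij).comp hm hm
  set M : α × α → ℝ := fun x => ∑ i, ∫ ω, c i ω x.1 * c i ω x.2 ∂μ with hM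
  -- These are the entries of `ZᵀZ` minus its mean, so `∑ x, D x ω ^ 2` is a squared Frobenius norm.
  set D : α × α → Ω → ℝ := fun x ω => ∑ i, c i ω x.1 * c i ω x.2 - M x with hD
  have hDL : ∀ x, MemLp (D x) 2 μ := fun x =>
    (memLp_finsetSum _ fun i _ => hU x i).sub (memLp_const _)
  have hDint : Integrable (fun ω => ∑ x, D x ω ^ 2) μ :=
    integrable_finsetSum _ fun x _ => (hDL x).integrable_sq
  have hDle : ∫ ω, ∑ x, D x ω ^ 2 ∂μ ≤ n * B ^ 2 := by
    rw [integral_finsetSum _ fun x _ => (hDL x).integrable_sq]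
    calc ∑ x, ∫ ω, D x ω ^ 2 ∂μ
        ≤ ∑ x : α × α, ∑ i, ∫ ω, (c i ω x.1 * c i ω x.2) ^ 2 ∂μ :=
          Finset.sum_le_sum fun x _ => integral_sq_sum_sub_integral_le (hU x) (hpair x)
      _ = ∑ i, ∫ ω, ∑ x : α × α, (c i ω x.1 * c i ω x.2) ^ 2 ∂μ := by
          rw [Finset.sum_comm]
          refine Finset.sum_congr rfl fun i _ => ?_
          rw [integral_finsetSum _ fun x _ => (hU x i).integrable_sq]
      _ ≤ ∑ i : Fin n, B ^ 2 := by
          refine Finset.sum_le_sum fun i _ => ?_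
          calc ∫ ω, ∑ x : α × α, (c i ω x.1 * c i ω x.2) ^ 2 ∂μ ≤ ∫ _, B ^ 2 ∂μ := by
                refine integral_mono_ae
                  (integrable_finsetSum _ fun x _ => (hU x i).integrable_sq)
                  (integrable_const _) ?_
                filter_upwards [hB i] with ω hω
                simp only [mul_pow, Fintype.sum_prod_type, ← Finset.mul_sum, ← Finset.sum_mul]
                rw [← sq]
                exact pow_le_pow_left₀ (Finset.sum_nonneg fun a _ => sq_nonneg _) hω 2
            _ = B ^ 2 := by simp
      _ = n * B ^ 2 := by simp
  have hmarkov : μ {ω | (n : ℝ) ^ 2 ≤ ∑ x, D x ω ^ 2} < 1 / 2 := by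
    have h := mul_meas_ge_le_integral_of_nonneg
      (ae_of_all μ fun ω => Finset.sum_nonneg fun x _ => sq_nonneg (D x ω)) hDint ((n : ℝ) ^ 2)
    have h2 : μ.real {ω | (n : ℝ) ^ 2 ≤ ∑ x, D x ω ^ 2} < 1 / 2 := by
      have h3 := h.trans hDle
      rw [← le_div_iff₀' (by positivity)] at h3
      refine lt_of_le_of_lt h3 (lt_of_eq_of_lt ?_ hBn)
      field_simp
    rw [Measure.real] at h2
    have h4 := (ENNReal.lt_ofReal_iff_toReal_lt (measure_ne_top μ _)).2 h2
    refine h4.trans_eq ?_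
    rw [ENNReal.ofReal_div_of_pos (by norm_num)]
    simp
  -- The bad sets have measures at most `1/2` and strictly below `1/2`, so they cannot cover the
  -- space. One good outcome is enough, since the conclusion is deterministic.
  obtain ⟨ω, hω1, hω2⟩ : ∃ ω, (∀ θ : α → ℝ, ∑ i, (∑ a, c i ω a * θ a) ^ 2
      ≤ n * C * ∑ a, θ a ^ 2) ∧ ∑ x, D x ω ^ 2 < (n : ℝ) ^ 2 := by
    by_contra! hcon
    have hcover : (Set.univ : Set Ω) ⊆ {ω | ¬ ∀ θ : α → ℝ, ∑ i, (∑ a, c i ω a * θ a) ^ 2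
        ≤ n * C * ∑ a, θ a ^ 2} ∪ {ω | (n : ℝ) ^ 2 ≤ ∑ x, D x ω ^ 2} := by
      intro ω _
      by_cases h : ∀ θ : α → ℝ, ∑ i, (∑ a, c i ω a * θ a) ^ 2 ≤ n * C * ∑ a, θ a ^ 2
      · exact Or.inr (hcon ω h)
      · exact Or.inl h
    have h1 := (measure_mono (μ := μ) hcover).trans (measure_union_le _ _)
    rw [measure_univ] at h1
    have h2 := h1.trans_lt (ENNReal.add_lt_add_of_le_of_lt (by simp) hC hmarkov)
    rw [ENNReal.add_halves] at h2
    exact lt_irrefl _ h2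
  have hexp : ∀ i ω, (∑ a, c i ω a * θ a) ^ 2
      = ∑ x : α × α, (θ x.1 * θ x.2) * (c i ω x.1 * c i ω x.2) := by
    intro i ω
    rw [sq, Finset.sum_mul_sum, Fintype.sum_prod_type]
    exact Finset.sum_congr rfl fun a _ => Finset.sum_congr rfl fun b _ => by ring
  have hlhs : ∑ i, ∫ ω, (∑ a, c i ω a * θ a) ^ 2 ∂μ = ∑ x : α × α, (θ x.1 * θ x.2) * M x := by
    simp only [hexp, hM, Finset.mul_sum]
    rw [Finset.sum_comm]
    refine Finset.sum_congr rfl fun i _ => ?_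
    rw [integral_finsetSum _ fun x _ => ((hU x i).integrable one_le_two).const_mul _]
    exact Finset.sum_congr rfl fun x _ => integral_const_mul _ _
  have hsplit : ∑ x : α × α, (θ x.1 * θ x.2) * M x
      = ∑ i, (∑ a, c i ω a * θ a) ^ 2 - ∑ x : α × α, (θ x.1 * θ x.2) * D x ω := by
    simp only [hexp, hD, mul_sub, Finset.sum_sub_distrib, Finset.mul_sum]
    rw [Finset.sum_comm]
    ring
  have hθ : ∑ x : α × α, (θ x.1 * θ x.2) ^ 2 = (∑ a, θ a ^ 2) ^ 2 := by
    simp only [mul_pow, Fintype.sum_prod_type, ← Finset.mul_sum, ← Finset.sum_mul]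
    rw [← sq]
  have hT : 0 ≤ ∑ a, θ a ^ 2 := Finset.sum_nonneg fun a _ => sq_nonneg _
  -- By Cauchy–Schwarz over pairs of indices, the quadratic form of `D` is at most its Frobenius
  -- norm times `|θ|²`.
  have hcs : |∑ x : α × α, (θ x.1 * θ x.2) * D x ω| ≤ n * ∑ a, θ a ^ 2 := by
    refine abs_le_of_sq_le_sq ?_ (by positivity)
    refine (Finset.sum_mul_sq_le_sq_mul_sq _ _ _).trans ?_
    rw [hθ, mul_pow, mul_comm]
    exact mul_le_mul_of_nonneg_right hω2.le (sq_nonneg _)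
  rw [hlhs, hsplit]
  have := hω1 θ
  have := neg_le_of_abs_le hcs
  nlinarith

/-! ### Quadratic forms of symmetric matrices -/

theorem le_dotProduct_mulVec_of_spectrum {α : Type*} [Fintype α] [DecidableEq α]
    {A : Matrix α α ℝ} (hA : A.IsHermitian) {c : ℝ} (h : ∀ x ∈ spectrum ℝ A, c ≤ x) (θ : α → ℝ) :
    c * ∑ a, θ a ^ 2 ≤ θ ⬝ᵥ A.mulVec θ := by
  have hps : (A - algebraMap ℝ (Matrix α α ℝ) c).PosSemidef := by
    rw [Matrix.posSemidef_iff_isHermitian_and_spectrum_nonneg]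
    refine ⟨hA.sub ?_, ?_⟩
    · rw [Matrix.IsHermitian, Matrix.algebraMap_eq_diagonal, Matrix.diagonal_conjTranspose]
      simp
    · rw [← spectrum.sub_singleton_eq]
      rintro _ ⟨x, hx, _, rfl, rfl⟩
      exact sub_nonneg.2 (h x hx)
  have h1 := hps.dotProduct_mulVec_nonneg θ
  rw [Matrix.sub_mulVec, dotProduct_sub, star_trivial, Algebra.algebraMap_eq_smul_one,
    Matrix.smul_mulVec, Matrix.one_mulVec, dotProduct_smul, smul_eq_mul] at h1
  have h2 : θ ⬝ᵥ θ = ∑ a, θ a ^ 2 := by simp [dotProduct, sq]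
  rw [h2] at h1
  linarith

theorem dotProduct_mulVec_le_of_spectrum {α : Type*} [Fintype α] [DecidableEq α]
    {A : Matrix α α ℝ} (hA : A.IsHermitian) {c : ℝ} (h : ∀ x ∈ spectrum ℝ A, x ≤ c) (θ : α → ℝ) :
    θ ⬝ᵥ A.mulVec θ ≤ c * ∑ a, θ a ^ 2 := by
  have h1 := le_dotProduct_mulVec_of_spectrum hA.neg (c := -c) (fun x hx => by
    rw [← spectrum.neg_eq, Set.mem_neg] at hx
    linarith [h _ hx]) θ
  rw [Matrix.neg_mulVec, dotProduct_neg] at h1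
  linarith

theorem dotProduct_gram_mulVec {n : ℕ} {α : Type*} [Fintype α] (Z : Matrix (Fin n) α ℝ)
    (θ : α → ℝ) :
    θ ⬝ᵥ ((n : ℝ)⁻¹ • (Z.transpose * Z)).mulVec θ = (n : ℝ)⁻¹ * ∑ i, (∑ a, Z i a * θ a) ^ 2 := by
  rw [Matrix.smul_mulVec, dotProduct_smul, smul_eq_mul, ← Matrix.mulVec_mulVec,
    Matrix.dotProduct_mulVec, Matrix.vecMul_transpose]
  simp only [dotProduct, Matrix.mulVec, sq]

theorem sum_sq_bounds_of_spectrum {n : ℕ} (hn : 0 < n) {α : Type*} [Fintype α] [DecidableEq α]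
    {Z : Matrix (Fin n) α ℝ} {c₀ C₀ : ℝ}
    (h : ∀ x ∈ spectrum ℝ ((n : ℝ)⁻¹ • (Z.transpose * Z)), c₀ ≤ x ∧ x ≤ C₀) (θ : α → ℝ) :
    n * c₀ * ∑ a, θ a ^ 2 ≤ ∑ i, (∑ a, Z i a * θ a) ^ 2 ∧
      ∑ i, (∑ a, Z i a * θ a) ^ 2 ≤ n * C₀ * ∑ a, θ a ^ 2 := by
  have hn' : (0 : ℝ) < n := Nat.cast_pos.2 hn
  have hA : ((n : ℝ)⁻¹ • (Z.transpose * Z)).IsHermitian := by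
    rw [Matrix.IsHermitian, Matrix.conjTranspose_eq_transpose_of_trivial, Matrix.transpose_smul,
      Matrix.transpose_mul, Matrix.transpose_transpose]
  have h1 := le_dotProduct_mulVec_of_spectrum hA (fun x hx => (h x hx).1) θ
  have h2 := dotProduct_mulVec_le_of_spectrum hA (fun x hx => (h x hx).2) θ
  rw [dotProduct_gram_mulVec] at h1 h2
  rw [← div_eq_inv_mul, le_div_iff₀ hn'] at h1
  rw [← div_eq_inv_mul, div_le_iff₀ hn'] at h2
  constructor <;> linarith

/-! ### The basic inequality of penalized least squares -/

/-- After the squares are expanded, the misfit and noise cross terms are each absorbed into a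
quarter of `W = |Zθ|²` by Young's inequality. The noise is first written as `⟨Zᵀε, θ⟩`, and the
resulting multiple of `|θ|²` is absorbed through `n c₀ |θ|² ≤ W`. -/
theorem sum_sq_le_of_basic_inequality {n : ℕ} (hn : 0 < n) {α : Type*} [Fintype α]
    {c : Fin n → α → ℝ} {d ε : Fin n → ℝ} {θ : α → ℝ} {c₀ D pen : ℝ} (hc₀ : 0 < c₀)
    (hbasic : ∑ i, (d i + ε i - ∑ a, c i a * θ a) ^ 2 ≤ ∑ i, (d i + ε i) ^ 2 + pen)
    (hlow : n * c₀ * ∑ a, θ a ^ 2 ≤ ∑ i, (∑ a, c i a * θ a) ^ 2) (hd : ∀ i, |d i| ≤ D) :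
    ∑ a, θ a ^ 2 ≤ 2 / c₀ *
      (4 * D ^ 2 + 4 / c₀ * (∑ a, (∑ i, c i a * ε i) ^ 2) / n ^ 2 + pen / n) := by
  have hn' : (0 : ℝ) < n := Nat.cast_pos.2 hn
  set w : Fin n → ℝ := fun i => ∑ a, c i a * θ a with hw
  set W := ∑ i, w i ^ 2 with hW
  set T := ∑ a, θ a ^ 2 with hT
  set E := ∑ a, (∑ i, c i a * ε i) ^ 2 with hE
  have h1 : W ≤ 2 * ∑ i, d i * w i + 2 * ∑ i, ε i * w i + pen := by
    have : ∑ i, (d i + ε i - w i) ^ 2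
        = ∑ i, (d i + ε i) ^ 2 - 2 * ∑ i, d i * w i - 2 * ∑ i, ε i * w i + W := by
      rw [Finset.mul_sum, Finset.mul_sum, hW, ← Finset.sum_sub_distrib, ← Finset.sum_sub_distrib,
        ← Finset.sum_add_distrib]
      exact Finset.sum_congr rfl fun i _ => by ring
    linarith
  have h2 : 2 * ∑ i, d i * w i ≤ 4 * (n * D ^ 2) + W / 4 := by
    have : ∑ i, d i * w i ≤ ∑ i, (2 * D ^ 2 + w i ^ 2 / 8) := by
      refine Finset.sum_le_sum fun i _ => ?_
      have hdi : d i ^ 2 ≤ D ^ 2 := by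
        rw [← sq_abs]; exact pow_le_pow_left₀ (abs_nonneg _) (hd i) 2
      nlinarith [sq_nonneg (4 * d i - w i)]
    rw [Finset.sum_add_distrib, ← Finset.sum_div] at this
    simp only [Finset.sum_const, Finset.card_univ, Fintype.card_fin, nsmul_eq_mul] at this
    linarith
  have h3 : 2 * ∑ i, ε i * w i ≤ 4 / (n * c₀) * E + W / 4 := by
    have e : ∑ i, ε i * w i = ∑ a, (∑ i, c i a * ε i) * θ a := by
      simp only [hw, Finset.mul_sum, Finset.sum_mul]
      rw [Finset.sum_comm]
      exact Finset.sum_congr rfl fun i _ => Finset.sum_congr rfl fun a _ => by ring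
    have h4 : 2 * ∑ i, ε i * w i ≤ 4 / (n * c₀) * E + n * c₀ / 4 * T := by
      rw [e, hE, hT, Finset.mul_sum, Finset.mul_sum, Finset.mul_sum, ← Finset.sum_add_distrib]
      refine Finset.sum_le_sum fun a _ => ?_
      set x := ∑ i, c i a * ε i
      have hnc : 0 < n * c₀ := by positivity
      have : 4 / (n * c₀) * x ^ 2 + n * c₀ / 4 * θ a ^ 2 - 2 * (x * θ a)
          = (4 * x - n * c₀ * θ a) ^ 2 / (4 * (n * c₀)) := by
        field_simp
        ring
      have : 0 ≤ (4 * x - n * c₀ * θ a) ^ 2 / (4 * (n * c₀)) := by positivity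
      linarith
    linarith
  have h5 : n * c₀ * T ≤ 8 * (n * D ^ 2) + 8 / (n * c₀) * E + 2 * pen := by
    have : 4 / (n * c₀) * E = 8 / (n * c₀) * E / 2 := by ring
    linarith
  have h6 : 2 / c₀ * (4 * D ^ 2 + 4 / c₀ * E / n ^ 2 + pen / n)
      = (8 * (n * D ^ 2) + 8 / (n * c₀) * E + 2 * pen) / (n * c₀) := by
    field_simp
    ring
  rw [h6, le_div_iff₀ (by positivity)]
  linarith

/-! ### Inner products of splines -/

theorem sq_integral_le {Ω : Type*} [MeasurableSpace Ω] {μ : Measure Ω} [IsProbabilityMeasure μ]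
    {f : Ω → ℝ} (hf : MemLp f 2 μ) : (∫ x, f x ∂μ) ^ 2 ≤ ∫ x, f x ^ 2 ∂μ := by
  have h := variance_nonneg f μ
  rw [variance_eq_sub hf] at h
  simpa using h

theorem memLp_unitInterval {f : unitInterval → ℝ} (hf : Continuous f) (p : ℝ≥0∞) :
    MemLp f p volume := by
  obtain ⟨M, hM⟩ := isCompact_univ.exists_bound_of_continuousOn hf.continuousOn
  exact MemLp.of_bound hf.aestronglyMeasurable M (ae_of_all _ fun x => hM x (Set.mem_univ x))

theorem integrable_unitInterval {f : unitInterval → ℝ} (hf : Continuous f) : Integrable f :=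
  memLp_one_iff_integrable.1 (memLp_unitInterval hf 1)

theorem abs_integral_mul_le {x f : unitInterval → ℝ} {C : ℝ} (hf : Continuous f)
    (hx : ∀ t, |x t| ≤ C) :
    |∫ t, x t * f t| ≤ C * √(∫ t, f t ^ 2) := by
  have hC : 0 ≤ C := (abs_nonneg _).trans (hx 0)
  have h1 : |∫ t, x t * f t| ≤ ∫ t, C * |f t| := by
    rw [← Real.norm_eq_abs]
    refine norm_integral_le_of_norm_le
      (integrable_unitInterval (continuous_const.mul hf.abs)) (ae_of_all _ ?_)
    intro t
    rw [norm_mul]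
    exact mul_le_mul_of_nonneg_right (hx t) (abs_nonneg _)
  refine h1.trans ?_
  rw [integral_const_mul]
  refine mul_le_mul_of_nonneg_left (Real.le_sqrt_of_sq_le ?_) hC
  simpa using sq_integral_le (memLp_unitInterval hf.abs 2)

/-- The inner products of `f` with the basis functions. -/
def basisInner {K : ℕ} (ψ : Fin K → ℝ → ℝ) (f : ℝ → ℝ) (l : Fin K) : ℝ :=
  ∫ t : unitInterval, ψ l t * f t

theorem continuous_combine {K : ℕ} {ψ : Fin K → ℝ → ℝ} (hψ : ∀ l, Continuous (ψ l))
    (a : Fin K → ℝ) : Continuous (combine ψ a) := by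
  unfold combine
  fun_prop

theorem combine_mem_span {K : ℕ} (ψ : Fin K → ℝ → ℝ) (a : Fin K → ℝ) :
    combine ψ a ∈ Submodule.span ℝ (Set.range ψ) := by
  have : combine ψ a = ∑ l, a l • ψ l := by
    funext t
    simp [combine, Finset.sum_apply]
  rw [this]
  exact Submodule.sum_mem _ fun l _ =>
    Submodule.smul_mem _ _ (Submodule.subset_span (Set.mem_range_self l))

theorem exists_combine_eq {K : ℕ} {ψ : Fin K → ℝ → ℝ} {f : ℝ → ℝ}
    (hf : f ∈ Submodule.span ℝ (Set.range ψ)) : ∃ a, combine ψ a = f := by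
  obtain ⟨a, ha⟩ := (Submodule.mem_span_range_iff_exists_fun ℝ).1 hf
  refine ⟨a, ?_⟩
  rw [← ha]
  funext t
  simp [combine, Finset.sum_apply]

theorem combine_sub {K : ℕ} (ψ : Fin K → ℝ → ℝ) (a b : Fin K → ℝ) (t : ℝ) :
    combine ψ (a - b) t = combine ψ a t - combine ψ b t := by
  simp [combine, sub_mul]

theorem integral_combine_mul {K : ℕ} {ψ : Fin K → ℝ → ℝ} (hψ : ∀ l, Continuous (ψ l))
    (a : Fin K → ℝ) {f : ℝ → ℝ} (hf : Continuous f) :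
    ∫ t : unitInterval, combine ψ a t * f t = ∑ l, a l * basisInner ψ f l := by
  simp only [combine, Finset.sum_mul, basisInner]
  rw [integral_finsetSum _ fun l _ => integrable_unitInterval (by have := hψ l; fun_prop)]
  refine Finset.sum_congr rfl fun l _ => ?_
  rw [← integral_const_mul]
  simp only [mul_assoc]

/-- With `f = combine ψ a`, `‖f‖² = ∑ aₗ ⟨ψₗ, f⟩`. Cauchy–Schwarz and `κ |a|² ≤ ‖f‖²` give `κ ‖f‖⁴ ≤
‖f‖² ∑ ⟨ψₗ, f⟩²`, and one factor `‖f‖²` cancels. -/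
theorem integral_sq_combine_le {K : ℕ} {ψ : Fin K → ℝ → ℝ} (hψ : ∀ l, Continuous (ψ l)) {κ : ℝ}
    (hκ : 0 < κ) (a : Fin K → ℝ)
    (hG : κ * ∑ l, a l ^ 2 ≤ ∫ t : unitInterval, combine ψ a t ^ 2) :
    ∫ t : unitInterval, combine ψ a t ^ 2 ≤ κ⁻¹ * ∑ l, basisInner ψ (combine ψ a) l ^ 2 := by
  set I := ∫ t : unitInterval, combine ψ a t ^ 2 with hI
  set T := ∑ l, basisInner ψ (combine ψ a) l ^ 2 with hT
  have hI0 : 0 ≤ I := integral_nonneg fun t => sq_nonneg _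
  have hT0 : 0 ≤ T := Finset.sum_nonneg fun l _ => sq_nonneg _
  have e : I = ∑ l, a l * basisInner ψ (combine ψ a) l := by
    rw [← integral_combine_mul hψ a (continuous_combine hψ a), hI]
    simp only [sq]
  have h1 : I ^ 2 ≤ (∑ l, a l ^ 2) * T := by
    nth_rewrite 1 [e]
    exact Finset.sum_mul_sq_le_sq_mul_sq _ _ _
  rcases hI0.eq_or_lt with h | h
  · rw [← h]; positivity
  rw [← div_eq_inv_mul, le_div_iff₀ hκ]
  have h2 : (κ * I) * I ≤ T * I := by nlinarith [mul_le_mul_of_nonneg_right hG hT0]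
  linarith [le_of_mul_le_mul_right h2 h]

/-- The approximation property is tested on the represented predictor `ẑ` itself: `‖ẑ‖² = ⟨ẑ - x, ẑ⟩
+ ⟨x, ẑ⟩ ≤ (|δ| + C) ‖ẑ‖`. -/
theorem integral_sq_combine_le_of_approx {K : ℕ} {ψ : Fin K → ℝ → ℝ}
    (hψ : ∀ l, Continuous (ψ l)) (c : Fin K → ℝ) {x : unitInterval → ℝ} (hx : Continuous x)
    {C δ : ℝ} (hxC : ∀ t, |x t| ≤ C)
    (hc : |∫ t : unitInterval, (combine ψ c t - x t) * combine ψ c t|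
      ≤ δ * √(∫ t : unitInterval, combine ψ c t ^ 2)) :
    ∫ t : unitInterval, combine ψ c t ^ 2 ≤ (|δ| + C) ^ 2 := by
  have hcont : Continuous fun t : unitInterval => combine ψ c t :=
    (continuous_combine hψ c).comp continuous_subtype_val
  set I := ∫ t : unitInterval, combine ψ c t ^ 2 with hI
  have hI0 : 0 ≤ I := integral_nonneg fun t => sq_nonneg _
  have h1 := abs_integral_mul_le hcont hxC
  have e : I = (∫ t : unitInterval, (combine ψ c t - x t) * combine ψ c t)
      + ∫ t : unitInterval, x t * combine ψ c t := by
    rw [← integral_add (integrable_unitInterval (by fun_prop))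
      (integrable_unitInterval (by fun_prop)), hI]
    congr 1
    funext t
    ring
  have h2 : I ≤ (|δ| + C) * √I := by
    have := le_abs_self (∫ t : unitInterval, (combine ψ c t - x t) * combine ψ c t)
    have := le_abs_self (∫ t : unitInterval, x t * combine ψ c t)
    have := mul_le_mul_of_nonneg_right (le_abs_self δ) (Real.sqrt_nonneg I)
    linarith
  have hs := Real.sq_sqrt hI0
  have h3 : √I ≤ |δ| + C := by
    rcases (Real.sqrt_nonneg I).eq_or_lt with h | h
    · rw [← h]
      have := (abs_nonneg _).trans (hxC 0)
      positivity
    · refine le_of_mul_le_mul_right ?_ h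
      rw [← sq, hs]
      exact h2
  rw [← hs]
  exact pow_le_pow_left₀ (Real.sqrt_nonneg _) h3 2

/-! ### The linear predictor -/

theorem linearPredictor_sub {p : ℕ} {x : Fin p → unitInterval → ℝ} (hx : ∀ j, Continuous (x j))
    {f g : Fin p → ℝ → ℝ} (hf : ∀ j, Continuous fun t : unitInterval => f j t)
    (hg : ∀ j, Continuous fun t : unitInterval => g j t) :
    linearPredictor x (fun j t => f j t - g j t) = linearPredictor x f - linearPredictor x g := by
  simp only [linearPredictor, mul_sub]
  rw [← Finset.sum_sub_distrib]
  refine Finset.sum_congr rfl fun j _ => ?_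
  exact integral_sub (integrable_unitInterval ((hx j).mul (hf j)))
    (integrable_unitInterval ((hx j).mul (hg j)))

theorem linearPredictor_sub_left {p : ℕ} {x y : Fin p → unitInterval → ℝ}
    (hx : ∀ j, Continuous (x j)) (hy : ∀ j, Continuous (y j))
    {f : Fin p → ℝ → ℝ} (hf : ∀ j, Continuous fun t : unitInterval => f j t) :
    linearPredictor (fun j t => x j t - y j t) f = linearPredictor x f - linearPredictor y f := by
  simp only [linearPredictor, sub_mul]
  rw [← Finset.sum_sub_distrib]
  refine Finset.sum_congr rfl fun j _ => ?_
  exact integral_sub (integrable_unitInterval ((hx j).mul (hf j)))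
    (integrable_unitInterval ((hy j).mul (hf j)))

theorem linearPredictor_combine {p K : ℕ} {ψ : Fin K → ℝ → ℝ} (hψ : ∀ l, Continuous (ψ l))
    (c : Fin p → Fin K → ℝ) {f : Fin p → ℝ → ℝ} (hf : ∀ j, Continuous (f j)) :
    linearPredictor (fun j (t : unitInterval) => combine ψ (c j) t) f
      = ∑ a : Fin p × Fin K, c a.1 a.2 * basisInner ψ (f a.1) a.2 := by
  rw [linearPredictor, Fintype.sum_prod_type]
  exact Finset.sum_congr rfl fun j _ => integral_combine_mul hψ (c j) (hf j)

theorem abs_linearPredictor_le {p : ℕ} {x : Fin p → unitInterval → ℝ} {C e : ℝ} (hC : 0 ≤ C)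
    (hxC : ∀ j t, |x j t| ≤ C) {f : Fin p → ℝ → ℝ}
    (hf : ∀ j, Continuous fun t : unitInterval => f j t) (he : ∀ j (t : unitInterval), |f j t| ≤ e) :
    |linearPredictor x f| ≤ p * (C * e) := by
  refine (Finset.abs_sum_le_sum_abs _ _).trans ((Finset.sum_le_card_nsmul _ _ (C * e) ?_).trans
    (by simp))
  intro j _
  refine (abs_integral_mul_le (hf j) (hxC j)).trans (mul_le_mul_of_nonneg_left ?_ hC)
  have he0 : 0 ≤ e := (abs_nonneg _).trans (he j 0)
  rw [Real.sqrt_le_left he0]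
  calc ∫ t : unitInterval, f j t ^ 2 ≤ ∫ _ : unitInterval, e ^ 2 := by
        refine integral_mono (integrable_unitInterval ((hf j).pow 2)) (integrable_const _) ?_
        intro t
        have := pow_le_pow_left₀ (abs_nonneg _) (he j t) 2
        rwa [sq_abs] at this
    _ = e ^ 2 := by simp

/-- Arrays of continuous functions, with the σ-algebra generated by the evaluations. -/
abbrev ContinuousPaths (p : ℕ) : Type :=
  {x : Fin p → unitInterval → ℝ // ∀ j, Continuous (x j)}

/-- On continuous paths evaluation is jointly measurable in time and path, so the integral over time
is measurable for the σ-algebra of evaluations. On arbitrary functions this argument is not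
available, hence the subtype. -/
theorem measurable_linearPredictor_val {p : ℕ} {f : Fin p → ℝ → ℝ}
    (hf : ∀ j, Continuous fun t : unitInterval => f j t) :
    Measurable fun x : ContinuousPaths p => linearPredictor x.1 f := by
  refine Finset.measurable_fun_sum _ fun j _ => ?_
  have h : Measurable (Function.uncurry fun (t : unitInterval) (x : ContinuousPaths p) =>
      x.1 j t * f j t) := by
    refine measurable_uncurry_of_continuous_of_measurable (fun x => (x.2 j).mul (hf j)) fun t => ?_
    have h1 : Measurable fun x : ContinuousPaths p => x.1 j t :=
      (measurable_pi_apply t).comp ((measurable_pi_apply j).comp measurable_subtype_coe)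
    exact h1.mul_const _
  exact h.stronglyMeasurable.integral_prod_left.measurable

theorem measurable_linearPredictor {Ω : Type*} [MeasurableSpace Ω] {p : ℕ}
    {X : Ω → Fin p → unitInterval → ℝ} (hX : Measurable X) (hXc : ∀ ω j, Continuous (X ω j))
    {f : Fin p → ℝ → ℝ} (hf : ∀ j, Continuous fun t : unitInterval => f j t) :
    Measurable fun ω => linearPredictor (X ω) f :=
  (measurable_linearPredictor_val hf).comp
    (hX.subtype_mk : Measurable fun ω => (⟨X ω, hXc ω⟩ : ContinuousPaths p))

/-- Measurable sets of continuous paths are traces of measurable sets of all functions, so equality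
in law passes to `ContinuousPaths`, where the linear predictor is measurable. -/
theorem predictionNormSq_eq_of_identDistrib {Ω : Type*} [MeasurableSpace Ω] {μ : Measure Ω}
    {p : ℕ} {X Y : Ω → Fin p → unitInterval → ℝ} (hX : Measurable X) (hY : Measurable Y)
    (hXc : ∀ ω j, Continuous (X ω j)) (hYc : ∀ ω j, Continuous (Y ω j))
    (hid : IdentDistrib X Y μ μ) {f : Fin p → ℝ → ℝ}
    (hf : ∀ j, Continuous fun t : unitInterval => f j t) :
    predictionNormSq μ X f = predictionNormSq μ Y f := by
  have hX' : Measurable fun ω => (⟨X ω, hXc ω⟩ : ContinuousPaths p) := hX.subtype_mk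
  have hY' : Measurable fun ω => (⟨Y ω, hYc ω⟩ : ContinuousPaths p) := hY.subtype_mk
  have h : IdentDistrib (fun ω => (⟨X ω, hXc ω⟩ : ContinuousPaths p))
      (fun ω => (⟨Y ω, hYc ω⟩ : ContinuousPaths p)) μ μ := by
    refine ⟨hX'.aemeasurable, hY'.aemeasurable, ?_⟩
    ext s hs
    obtain ⟨t, ht, rfl⟩ := hs
    rw [Measure.map_apply hX' (measurable_subtype_coe ht),
      Measure.map_apply hY' (measurable_subtype_coe ht)]
    exact hid.measure_mem_eq ht
  exact (h.comp ((measurable_linearPredictor_val hf).pow_const 2)).integral_eq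

theorem ae_abs_linearPredictor_le {Ω : Type*} [MeasurableSpace Ω] {μ : Measure Ω} {p : ℕ}
    {X : Ω → Fin p → unitInterval → ℝ} {C : ℝ} (hC : 0 ≤ C)
    (hXC : ∀ j, ∀ᵐ ω ∂μ, ∀ t, |X ω j t| ≤ C) {f : Fin p → ℝ → ℝ}
    (hf : ∀ j, Continuous fun t : unitInterval => f j t) {e : ℝ}
    (he : ∀ j (t : unitInterval), |f j t| ≤ e) :
    ∀ᵐ ω ∂μ, |linearPredictor (X ω) f| ≤ p * (C * e) := by
  filter_upwards [ae_all_iff.2 hXC] with ω hω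
  exact abs_linearPredictor_le hC hω hf he

theorem memLp_linearPredictor {Ω : Type*} [MeasurableSpace Ω] {μ : Measure Ω} [IsFiniteMeasure μ]
    {p : ℕ} {X : Ω → Fin p → unitInterval → ℝ} (hX : Measurable X)
    (hXc : ∀ ω j, Continuous (X ω j)) {C : ℝ} (hC : 0 ≤ C)
    (hXC : ∀ j, ∀ᵐ ω ∂μ, ∀ t, |X ω j t| ≤ C) {f : Fin p → ℝ → ℝ}
    (hf : ∀ j, Continuous fun t : unitInterval => f j t) :
    MemLp (fun ω => linearPredictor (X ω) f) 2 μ := by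
  have hbd : ∀ j, ∃ M, ∀ t : unitInterval, |f j t| ≤ M := by
    intro j
    obtain ⟨M, hM⟩ := isCompact_univ.exists_bound_of_continuousOn (hf j).continuousOn
    exact ⟨M, fun t => hM t (Set.mem_univ t)⟩
  choose M hM using hbd
  refine MemLp.of_bound (measurable_linearPredictor hX hXc hf).aestronglyMeasurable
    (p * (C * ∑ j, |M j|)) (ae_abs_linearPredictor_le hC hXC hf fun j t => (hM j t).trans ?_)
  exact (le_abs_self _).trans
    (Finset.single_le_sum (f := fun j => |M j|) (fun j _ => abs_nonneg _) (Finset.mem_univ j))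

theorem predictionNormSq_sub_le {Ω : Type*} [MeasurableSpace Ω] {μ : Measure Ω}
    [IsProbabilityMeasure μ] {p : ℕ} {X : Ω → Fin p → unitInterval → ℝ} (hX : Measurable X)
    (hXc : ∀ ω j, Continuous (X ω j)) {C : ℝ} (hC : 0 ≤ C)
    (hXC : ∀ j, ∀ᵐ ω ∂μ, ∀ t, |X ω j t| ≤ C) {f g h : Fin p → ℝ → ℝ}
    (hf : ∀ j, Continuous fun t : unitInterval => f j t)
    (hg : ∀ j, Continuous fun t : unitInterval => g j t)
    (hh : ∀ j, Continuous fun t : unitInterval => h j t)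
    {e : ℝ} (he : ∀ j (t : unitInterval), |g j t - h j t| ≤ e) :
    predictionNormSq μ X (fun j t => f j t - h j t)
      ≤ 2 * predictionNormSq μ X (fun j t => f j t - g j t) + 2 * (p * (C * e)) ^ 2 := by
  have hL : ∀ {u : Fin p → ℝ → ℝ}, (∀ j, Continuous fun t : unitInterval => u j t) →
      Integrable (fun ω => linearPredictor (X ω) u ^ 2) μ := fun hu =>
    (memLp_linearPredictor hX hXc hC hXC hu).integrable_sq
  have hfg := hL (u := fun j t => f j t - g j t) fun j => (hf j).sub (hg j)
  rw [predictionNormSq, predictionNormSq, ← integral_const_mul]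
  calc ∫ ω, linearPredictor (X ω) (fun j t => f j t - h j t) ^ 2 ∂μ
      ≤ ∫ ω, (2 * linearPredictor (X ω) (fun j t => f j t - g j t) ^ 2
          + 2 * (p * (C * e)) ^ 2) ∂μ := by
        refine integral_mono_ae (hL (u := fun j t => f j t - h j t) fun j => (hf j).sub (hh j))
          ((hfg.const_mul 2).add (integrable_const _)) ?_
        filter_upwards [ae_abs_linearPredictor_le hC hXC (f := fun j t => g j t - h j t)
          (fun j => (hg j).sub (hh j)) he] with ω hω
        have hsq := pow_le_pow_left₀ (abs_nonneg _) hω 2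
        rw [sq_abs, linearPredictor_sub (hXc ω) hg hh] at hsq
        rw [linearPredictor_sub (hXc ω) hf hh, linearPredictor_sub (hXc ω) hf hg]
        nlinarith [sq_nonneg (linearPredictor (X ω) f - linearPredictor (X ω) g
          - (linearPredictor (X ω) g - linearPredictor (X ω) h))]
    _ = _ := by
        rw [integral_add (hfg.const_mul 2) (integrable_const _)]
        simp

/-! ### The prediction norm of a spline -/

/-- The vector of inner products of `∑ₗ bⱼₗ ψₗ` with the basis functions. -/
def stackedInner {p K : ℕ} (ψ : Fin K → ℝ → ℝ) (b : Fin p → Fin K → ℝ) (a : Fin p × Fin K) : ℝ :=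
  basisInner ψ (combine ψ (b a.1)) a.2

theorem sum_integral_sq_combine_le {p K : ℕ} {ψ : Fin K → ℝ → ℝ} (hψ : ∀ l, Continuous (ψ l))
    {κ : ℝ} (hκ : 0 < κ)
    (hG : ∀ a : Fin K → ℝ, κ * ∑ l, a l ^ 2 ≤ ∫ t : unitInterval, combine ψ a t ^ 2)
    (b : Fin p → Fin K → ℝ) :
    ∑ j, ∫ t : unitInterval, combine ψ (b j) t ^ 2 ≤ κ⁻¹ * ∑ a, stackedInner ψ b a ^ 2 := by
  rw [Fintype.sum_prod_type, Finset.mul_sum]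
  exact Finset.sum_le_sum fun j _ => integral_sq_combine_le hψ hκ (b j) (hG (b j))

theorem abs_linearPredictor_sub_combine_le {p K : ℕ} {ψ : Fin K → ℝ → ℝ}
    (hψ : ∀ l, Continuous (ψ l)) {x : Fin p → unitInterval → ℝ} (hx : ∀ j, Continuous (x j))
    {c : Fin p → Fin K → ℝ} {f : Fin p → ℝ → ℝ} (hf : ∀ j, Continuous (f j)) {δ : ℝ}
    (hc : ∀ j, |∫ t : unitInterval, (combine ψ (c j) t - x j t) * f j t|
      ≤ δ * √(∫ t : unitInterval, f j t ^ 2)) :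
    |linearPredictor x f - linearPredictor (fun j (t : unitInterval) => combine ψ (c j) t) f|
      ≤ ∑ j, δ * √(∫ t : unitInterval, f j t ^ 2) := by
  rw [abs_sub_comm, ← linearPredictor_sub_left (x := fun j (t : unitInterval) => combine ψ (c j) t)
    (fun j => (continuous_combine hψ (c j)).comp continuous_subtype_val) hx
    (fun j => (hf j).comp continuous_subtype_val)]
  exact (Finset.abs_sum_le_sum_abs _ _).trans (Finset.sum_le_sum fun j _ => hc j)

/-- The predictor is replaced by its spline representation. The error is at most `δ ∑ ‖fⱼ‖`, and `∑
‖fⱼ‖²` is controlled by `|θ|² / κ`; the main part is the mean quadratic form bounded by `hM`. -/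
theorem predictionNormSq_combine_le {Ω : Type*} [MeasurableSpace Ω] {μ : Measure Ω}
    [IsProbabilityMeasure μ] {n p K : ℕ} (hn : 0 < n) {X : ℕ → Ω → Fin p → unitInterval → ℝ}
    (hX : ∀ i, Measurable (X i)) (hXc : ∀ i ω j, Continuous (X i ω j))
    (hid : ∀ i, IdentDistrib (X i) (X 0) μ μ) {C : ℝ} (hC : 0 ≤ C)
    (hXC : ∀ i j, ∀ᵐ ω ∂μ, ∀ t, |X i ω j t| ≤ C)
    {ψ : Fin K → ℝ → ℝ} (hψ : ∀ l, Continuous (ψ l)) {κ : ℝ} (hκ : 0 < κ)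
    (hG : ∀ a : Fin K → ℝ, κ * ∑ l, a l ^ 2 ≤ ∫ t : unitInterval, combine ψ a t ^ 2)
    {c : Fin n → Ω → Fin p → Fin K → ℝ} (hcm : ∀ i, Measurable (c i)) {B δ M : ℝ}
    (hB : ∀ i, ∀ᵐ ω ∂μ, ∑ a : Fin p × Fin K, c i ω a.1 a.2 ^ 2 ≤ B)
    (hc : ∀ (i : Fin n) j, ∀ᵐ ω ∂μ, ∀ a : Fin K → ℝ,
      |∫ t : unitInterval, (combine ψ (c i ω j) t - X i ω j t) * combine ψ a t|
        ≤ δ * √(∫ t : unitInterval, combine ψ a t ^ 2))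
    (hM : ∀ θ : Fin p × Fin K → ℝ,
      ∑ i, ∫ ω, (∑ a, c i ω a.1 a.2 * θ a) ^ 2 ∂μ ≤ n * M * ∑ a, θ a ^ 2)
    (b : Fin p → Fin K → ℝ) :
    predictionNormSq μ (X 0) (fun j => combine ψ (b j))
      ≤ (2 * M + 2 * p * δ ^ 2 * κ⁻¹) * ∑ a, stackedInner ψ b a ^ 2 := by
  have hn' : (0 : ℝ) < n := Nat.cast_pos.2 hn
  set T := ∑ a, stackedInner ψ b a ^ 2 with hT
  have hcont : ∀ j, Continuous (combine ψ (b j)) := fun j => continuous_combine hψ (b j)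
  have hcont' : ∀ j, Continuous fun t : unitInterval => combine ψ (b j) t := fun j =>
    (hcont j).comp continuous_subtype_val
  set I : Fin p → ℝ := fun j => ∫ t : unitInterval, combine ψ (b j) t ^ 2 with hI
  have hI0 : ∀ j, 0 ≤ I j := fun j => integral_nonneg fun t => sq_nonneg _
  have hIT : ∑ j, I j ≤ κ⁻¹ * T := sum_integral_sq_combine_le hψ hκ hG b
  have herr : (∑ j, δ * √(I j)) ^ 2 ≤ p * δ ^ 2 * κ⁻¹ * T := by
    calc (∑ j, δ * √(I j)) ^ 2 ≤ p * ∑ j, (δ * √(I j)) ^ 2 := by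
          simpa using sq_sum_le_card_mul_sum_sq (s := Finset.univ) (f := fun j => δ * √(I j))
      _ = p * δ ^ 2 * ∑ j, I j := by
          simp only [mul_pow, Real.sq_sqrt (hI0 _), ← Finset.mul_sum]
          ring
      _ ≤ p * δ ^ 2 * (κ⁻¹ * T) := mul_le_mul_of_nonneg_left hIT (by positivity)
      _ = p * δ ^ 2 * κ⁻¹ * T := by ring
  have hWL : ∀ i, Integrable
      (fun ω => (∑ a : Fin p × Fin K, c i ω a.1 a.2 * stackedInner ψ b a) ^ 2) μ := by
    intro i
    refine MemLp.integrable_sq (memLp_finsetSum Finset.univ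
      (f := fun (a : Fin p × Fin K) ω => c i ω a.1 a.2 * stackedInner ψ b a)
      fun a _ => MemLp.mul_const ?_ _)
    have hm : Measurable fun ω => c i ω a.1 a.2 :=
      (measurable_pi_apply a.2).comp ((measurable_pi_apply a.1).comp (hcm i))
    refine MemLp.of_bound hm.aestronglyMeasurable (√B) ?_
    filter_upwards [hB i] with ω hω
    refine Real.abs_le_sqrt (le_trans ?_ hω)
    exact Finset.single_le_sum (f := fun a : Fin p × Fin K => c i ω a.1 a.2 ^ 2)
      (fun a _ => sq_nonneg _) (Finset.mem_univ a)
  have hstep : ∀ i : Fin n, predictionNormSq μ (X 0) (fun j => combine ψ (b j))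
      ≤ 2 * ∫ ω, (∑ a : Fin p × Fin K, c i ω a.1 a.2 * stackedInner ψ b a) ^ 2 ∂μ
        + 2 * (p * δ ^ 2 * κ⁻¹ * T) := by
    intro i
    rw [← predictionNormSq_eq_of_identDistrib (hX i) (hX 0) (hXc i) (hXc 0) (hid i) hcont',
      predictionNormSq]
    calc ∫ ω, linearPredictor (X i ω) (fun j => combine ψ (b j)) ^ 2 ∂μ
        ≤ ∫ ω, (2 * (∑ a : Fin p × Fin K, c i ω a.1 a.2 * stackedInner ψ b a) ^ 2
            + 2 * (p * δ ^ 2 * κ⁻¹ * T)) ∂μ := by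
          refine integral_mono_ae
            (memLp_linearPredictor (hX i) (hXc i) hC (hXC i) hcont').integrable_sq
            (((hWL i).const_mul 2).add (integrable_const _)) ?_
          filter_upwards [ae_all_iff.2 (hc i)] with ω hω
          have h1 := abs_linearPredictor_sub_combine_le hψ (hXc i ω) hcont
            (fun j => hω j (b j))
          have h2 := pow_le_pow_left₀ (abs_nonneg _) h1 2
          rw [sq_abs, linearPredictor_combine hψ (c i ω) hcont] at h2
          have h3 := h2.trans herr
          set u := linearPredictor (X i ω) fun j => combine ψ (b j)
          set v := ∑ a : Fin p × Fin K, c i ω a.1 a.2 * stackedInner ψ b a with hv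
          change (u - v) ^ 2 ≤ _ at h3
          change u ^ 2 ≤ 2 * v ^ 2 + _
          nlinarith [sq_nonneg (u - 2 * v)]
      _ = _ := by
          rw [integral_add ((hWL i).const_mul 2) (integrable_const _), integral_const_mul]
          simp
  -- The rows of coefficients need not be identically distributed, so only their average is
  -- controlled. The left side does not depend on `i`, which makes averaging harmless.
  have hsum := Finset.sum_le_sum fun (i : Fin n) (_ : i ∈ Finset.univ) => hstep i
  rw [Finset.sum_add_distrib, ← Finset.mul_sum] at hsum
  simp only [Finset.sum_const, Finset.card_univ, Fintype.card_fin, nsmul_eq_mul] at hsum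
  have hMb := hM (stackedInner ψ b)
  refine le_of_mul_le_mul_left ?_ hn'
  refine hsum.trans ?_
  calc _ ≤ 2 * (n * M * T) + n * (2 * (p * δ ^ 2 * κ⁻¹ * T)) := by linarith
    _ = _ := by ring

/-- Restates the approximation in terms of the dimension `k + q ≤ (q + 1) k`, and extends it by
continuity to the right endpoint. The single constant dominates those of the three bounds. -/
theorem exists_mem_splineSpace_approx {r m q : ℕ} {ν : ℝ} (hq : 1 ≤ q) (hmq : m ≤ q)
    (hν : ν ∈ Set.Icc (0 : ℝ) 1) (hrq : (r : ℝ) + ν ≤ q) {f : ℝ → ℝ} (hf : HolderClass r ν f) :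
    ∃ C : ℝ, 0 ≤ C ∧ ∀ k : ℕ, 0 < k → ∃ g ∈ splineSpace q k,
      (∀ t ∈ Set.Icc (0 : ℝ) 1, |g t - f t| ≤ C * ((k + q : ℕ) : ℝ) ^ (-((r : ℝ) + ν))) ∧
      (∀ t ∈ Set.Icc (0 : ℝ) 1, |g t| ≤ C) ∧
      ∫ t in (0 : ℝ)..1, (iteratedDeriv m g t) ^ 2 ≤ (C * ((k + q : ℕ) : ℝ) ^ (m + 1)) ^ 2 := by
  obtain ⟨C, hC0, hC⟩ := exists_splineSum_approx hν hrq hf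
  set s := (r : ℝ) + ν with hs
  have hs0 : 0 ≤ s := add_nonneg (Nat.cast_nonneg r) hν.1
  have hq0 : (0 : ℝ) ≤ q := Nat.cast_nonneg q
  have hpow : 0 ≤ ((q : ℝ) + 1) ^ s := by positivity
  have hmax : 0 ≤ 2 ^ m * ((q : ℝ) + 1) := by positivity
  refine ⟨C * (1 + ((q : ℝ) + 1) ^ s + 2 ^ m * ((q : ℝ) + 1)), by positivity, fun k hk => ?_⟩
  have hk' : (1 : ℝ) ≤ k := Nat.one_le_cast.2 hk
  obtain ⟨a, ha, hat⟩ := hC k hk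
  have hgc : Continuous (splineSum q k a) := continuous_splineSum hq k a
  have hclosure : ∀ t ∈ Set.Icc (0 : ℝ) 1, t ∈ closure (Set.Ico (0 : ℝ) 1) := by
    rw [closure_Ico zero_ne_one]; exact fun t ht => ht
  refine ⟨splineSum q k a, splineSum_mem_splineSpace q k a, fun t ht => ?_, fun t ht => ?_,
    (intervalIntegral_iteratedDeriv_splineSum_sq_le hmq hk ha).trans ?_⟩
  · have hIcc : |f t - splineSum q k a t| ≤ C * (k : ℝ) ^ (-s) := by
      refine ContinuousWithinAt.closure_le (hclosure t ht)
        (((hf.continuousOn t ht).mono Set.Ico_subset_Icc_self).sub hgc.continuousWithinAt).abs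
        continuousWithinAt_const hat
    rw [abs_sub_comm]
    refine hIcc.trans ?_
    have h1 : ((k + q : ℕ) : ℝ) ≤ (q + 1) * k := by push_cast; nlinarith
    have h2 : (k : ℝ) ^ (-s) ≤ ((q : ℝ) + 1) ^ s * ((k + q : ℕ) : ℝ) ^ (-s) := by
      have hK : (0 : ℝ) < ((k + q : ℕ) : ℝ) := by positivity
      rw [Real.rpow_neg (by positivity), Real.rpow_neg hK.le, ← div_eq_mul_inv,
        le_div_iff₀ (by positivity), ← div_eq_inv_mul, div_le_iff₀ (by positivity),
        ← Real.mul_rpow (by positivity) (by positivity)]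
      exact Real.rpow_le_rpow hK.le h1 hs0
    calc C * (k : ℝ) ^ (-s) ≤ C * (((q : ℝ) + 1) ^ s * ((k + q : ℕ) : ℝ) ^ (-s)) := by gcongr
      _ = C * ((q : ℝ) + 1) ^ s * ((k + q : ℕ) : ℝ) ^ (-s) := by ring
      _ ≤ _ := by gcongr; linarith
  · have : |splineSum q k a t| ≤ C := ContinuousWithinAt.closure_le (hclosure t ht)
      hgc.continuousWithinAt.abs continuousWithinAt_const fun y hy => abs_splineSum_le hk ha hy
    refine this.trans (le_mul_of_one_le_right hC0 ?_)
    linarith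
  · refine pow_le_pow_left₀ (by positivity) ?_ 2
    refine mul_le_mul_of_nonneg_right ?_ (by positivity)
    rw [mul_comm _ C]
    gcongr
    linarith

/-! ### Conditional moments -/

/-- Markov's inequality on `G`: since `G` is `m`-measurable, the conditional expectation and `F`
have the same integral over the exceedance set within `G`. -/
theorem measure_condLExp_gt_inter_le {Ω : Type*} {m m₀ : MeasurableSpace Ω} (hm : m ≤ m₀)
    (μ : Measure[m₀] Ω) [IsFiniteMeasure μ] (F : Ω → ℝ≥0∞) {G : Set Ω} (hG : MeasurableSet[m] G)
    {b t : ℝ} (ht : 0 < t) (hF : ∫⁻ ω in G, F ω ∂μ ≤ ENNReal.ofReal b) :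
    μ ({ω | ENNReal.ofReal t < condLExp m μ F ω} ∩ G) ≤ ENNReal.ofReal (b / t) := by
  have hmeas : Measurable[m] (condLExp m μ F) := measurable_condLExp m μ F
  set A := {ω | ENNReal.ofReal t < condLExp m μ F ω} ∩ G with hA
  have hAm : MeasurableSet[m] A :=
    MeasurableSet.inter (hmeas measurableSet_Ioi) hG
  have h1 : ENNReal.ofReal t * μ A ≤ ENNReal.ofReal b := by
    calc ENNReal.ofReal t * μ A = ∫⁻ _ in A, ENNReal.ofReal t ∂μ := by
          rw [setLIntegral_const]
      _ ≤ ∫⁻ ω in A, condLExp m μ F ω ∂μ :=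
          setLIntegral_mono' (hm _ hAm) fun ω hω => hω.1.le
      _ = ∫⁻ ω in A, F ω ∂μ := setLIntegral_condLExp hm μ F hAm
      _ ≤ ∫⁻ ω in G, F ω ∂μ := lintegral_mono_set Set.inter_subset_right
      _ ≤ _ := hF
  rw [ENNReal.ofReal_div_of_pos ht, ENNReal.le_div_iff_mul_le
    (Or.inl (ENNReal.ofReal_pos.2 ht).ne') (Or.inl ENNReal.ofReal_ne_top), mul_comm]
  exact h1

theorem integral_mul_eq_zero_of_condExp {Ω : Type*} {m m₀ : MeasurableSpace Ω} (hm : m ≤ m₀)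
    {μ : Measure[m₀] Ω} [IsFiniteMeasure μ] {f ε : Ω → ℝ} (hf : StronglyMeasurable[m] f)
    {B : ℝ} (hB : ∀ᵐ ω ∂μ, ‖f ω‖ ≤ B) (hε : Integrable ε μ) (h : μ[ε | m] =ᵐ[μ] 0) :
    ∫ ω, f ω * ε ω ∂μ = 0 := by
  have h1 := condExp_stronglyMeasurable_mul_of_bound hm hf hε B hB
  have h2 : ∫ ω, (f * ε) ω ∂μ = ∫ ω, (μ[f * ε | m]) ω ∂μ := (integral_condExp hm).symm
  have h3 : μ[f * ε | m] =ᵐ[μ] 0 := by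
    filter_upwards [h1, h] with ω h1 h2
    rw [h1, Pi.mul_apply, h2]
    simp
  rw [integral_congr_ae h3] at h2
  simpa using h2

theorem integral_sq_le_of_condVar_le {Ω : Type*} {m m₀ : MeasurableSpace Ω} (hm : m ≤ m₀)
    {μ : Measure[m₀] Ω} [IsProbabilityMeasure μ] {ε : Ω → ℝ} (hε : MemLp ε 2 μ)
    (h : μ[ε | m] =ᵐ[μ] 0) {V : ℝ} (hV : ∀ᵐ ω ∂μ, condVar m ε μ ω ≤ V) :
    ∫ ω, ε ω ^ 2 ∂μ ≤ V := by
  have h1 := integral_condVar_add_variance_condExp hm hε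
  have h2 : ∫ ω, ε ω ∂μ = 0 := by
    rw [← integral_condExp hm, integral_congr_ae h]
    simp
  have h3 : Var[μ[ε | m]; μ] = 0 := by
    rw [variance_congr h]
    exact variance_zero μ
  rw [h3, add_zero, variance_of_integral_eq_zero hε.aemeasurable h2] at h1
  rw [← h1]
  calc ∫ ω, condVar m ε μ ω ∂μ ≤ ∫ _, V ∂μ :=
        integral_mono_ae integrable_condVar (integrable_const _) hV
    _ = V := by simp

/-! ### The risk of the functional ridge estimator -/

/-- Minimality is tested against `b₀`, and the nonnegative penalty of `b` is dropped. The misfit `d`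
combines `⟨x, β - g⟩`, of size `p C e`, and `⟨x - ẑ, g⟩`, of size `p δ S`, where `g` is the spline
with coefficients `b₀`. -/
theorem sum_sq_stackedInner_le_of_isFRE {n p K m : ℕ} (hn : 0 < n)
    {x : Fin n → Fin p → unitInterval → ℝ} {ε : Fin n → ℝ} (hx : ∀ i j, Continuous (x i j))
    {C : ℝ} (hC : 0 ≤ C) (hxC : ∀ i j t, |x i j t| ≤ C)
    {ψ : Fin K → ℝ → ℝ} (hψ : ∀ l, Continuous (ψ l)) {c : Fin n → Fin p → Fin K → ℝ} {δ : ℝ}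
    (hδ : 0 ≤ δ)
    (hc : ∀ (i : Fin n) j, ∀ a : Fin K → ℝ,
      |∫ t : unitInterval, (combine ψ (c i j) t - x i j t) * combine ψ a t|
        ≤ δ * √(∫ t : unitInterval, combine ψ a t ^ 2))
    {β : Fin p → ℝ → ℝ} (hβ : ∀ j, Continuous fun t : unitInterval => β j t)
    (b₀ : Fin p → Fin K → ℝ) {e S : ℝ}
    (he : ∀ j (t : unitInterval), |combine ψ (b₀ j) t - β j t| ≤ e)
    (hS : ∀ j (t : unitInterval), |combine ψ (b₀ j) t| ≤ S)
    {lam P : ℝ} (hlam : 0 ≤ lam)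
    (hP : lam * ∑ j, ∫ t in (0 : ℝ)..1, (iteratedDeriv m (combine ψ (b₀ j)) t) ^ 2 ≤ P)
    {b : Fin p → Fin K → ℝ}
    (hb : IsFRE ψ m lam (fun i : Fin n => linearPredictor (x i) β + ε i) c b)
    {c₀ : ℝ} (hc₀ : 0 < c₀)
    (hlow : ∀ θ : Fin p × Fin K → ℝ,
      n * c₀ * ∑ a, θ a ^ 2 ≤ ∑ i, (∑ a, c i a.1 a.2 * θ a) ^ 2) :
    ∑ a, stackedInner ψ (b - b₀) a ^ 2 ≤ 2 / c₀ * (4 * (p * (C * e) + p * (δ * S)) ^ 2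
      + 4 / c₀ * (∑ a : Fin p × Fin K, (∑ i, c i a.1 a.2 * ε i) ^ 2) / n ^ 2 + P / n) := by
  set D := p * (C * e) + p * (δ * S) with hD
  have hcombc : ∀ b : Fin K → ℝ, Continuous fun t : unitInterval => combine ψ b t := fun b =>
    (continuous_combine hψ b).comp continuous_subtype_val
  set d : Fin n → ℝ := fun i => linearPredictor (x i) β
    - linearPredictor (fun j (t : unitInterval) => combine ψ (c i j) t)
      (fun j => combine ψ (b₀ j)) with hd
  have hdD : ∀ i, |d i| ≤ D := by
    intro i
    have h3 : |linearPredictor (x i) (fun j => combine ψ (b₀ j))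
        - linearPredictor (x i) β| ≤ p * (C * e) := by
      rw [← linearPredictor_sub (hx i) (fun j => hcombc _) hβ]
      exact abs_linearPredictor_le hC (hxC i) (fun j => (hcombc _).sub (hβ j)) he
    have h4 := abs_linearPredictor_sub_combine_le hψ (hx i)
      (fun j => continuous_combine hψ (b₀ j)) (fun j => hc i j (b₀ j))
    have h5 : ∑ j, δ * √(∫ t : unitInterval, combine ψ (b₀ j) t ^ 2) ≤ p * (δ * S) := by
      refine (Finset.sum_le_card_nsmul _ _ (δ * S) fun j _ => ?_).trans (by simp)
      have hS0 : 0 ≤ S := (abs_nonneg _).trans (hS j 0)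
      refine mul_le_mul_of_nonneg_left ((Real.sqrt_le_left hS0).2 ?_) hδ
      calc ∫ t : unitInterval, combine ψ (b₀ j) t ^ 2 ≤ ∫ _ : unitInterval, S ^ 2 := by
            refine integral_mono (integrable_unitInterval ((hcombc _).pow 2))
              (integrable_const _) fun t => ?_
            have := pow_le_pow_left₀ (abs_nonneg _) (hS j t) 2
            rwa [sq_abs] at this
        _ = S ^ 2 := by simp
    rw [abs_sub_comm] at h3
    calc |d i| = |(linearPredictor (x i) β
            - linearPredictor (x i) (fun j => combine ψ (b₀ j)))
          + (linearPredictor (x i) (fun j => combine ψ (b₀ j))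
            - linearPredictor (fun j (t : unitInterval) => combine ψ (c i j) t)
              (fun j => combine ψ (b₀ j)))| := by rw [sub_add_sub_cancel]
      _ ≤ D := (abs_add_le _ _).trans (add_le_add h3 (h4.trans h5))
  have hres : ∀ i : Fin n, linearPredictor (fun j (t : unitInterval) => combine ψ (c i j) t)
        (fun j => combine ψ (b j))
      = linearPredictor (fun j (t : unitInterval) => combine ψ (c i j) t)
        (fun j => combine ψ (b₀ j))
        + ∑ a : Fin p × Fin K, c i a.1 a.2 * stackedInner ψ (b - b₀) a := by
    intro i
    have e1 : ∑ a : Fin p × Fin K, c i a.1 a.2 * stackedInner ψ (b - b₀) a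
        = linearPredictor (fun j (t : unitInterval) => combine ψ (c i j) t)
          (fun j => combine ψ ((b - b₀) j)) :=
      (linearPredictor_combine hψ (c i) fun j => continuous_combine hψ _).symm
    have e2 : (fun j => combine ψ ((b - b₀) j))
        = fun j t => combine ψ (b j) t - combine ψ (b₀ j) t := by
      funext j t
      exact combine_sub ψ (b j) (b₀ j) t
    rw [e1, e2, linearPredictor_sub (fun j => hcombc _) (fun j => hcombc _) fun j => hcombc _]
    ring
  have hbasic : ∑ i : Fin n, (d i + ε i
      - ∑ a : Fin p × Fin K, c i a.1 a.2 * stackedInner ψ (b - b₀) a) ^ 2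
      ≤ ∑ i : Fin n, (d i + ε i) ^ 2 + P := by
    have h3 := hb b₀
    simp only [freCriterion, hres] at h3
    have h4 : 0 ≤ lam * ∑ j, ∫ t in (0 : ℝ)..1,
        (iteratedDeriv m (combine ψ (b j)) t) ^ 2 :=
      mul_nonneg hlam (Finset.sum_nonneg fun j _ =>
        intervalIntegral.integral_nonneg zero_le_one fun t _ => sq_nonneg _)
    have e1 : ∀ i : Fin n, d i + ε i = linearPredictor (x i) β + ε i
        - linearPredictor (fun j (t : unitInterval) => combine ψ (c i j) t)
          (fun j => combine ψ (b₀ j)) := fun i => by simp only [hd]; ring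
    have e2 : ∑ i : Fin n, (d i + ε i
        - ∑ a : Fin p × Fin K, c i a.1 a.2 * stackedInner ψ (b - b₀) a) ^ 2
        = ∑ i : Fin n, (linearPredictor (x i) β + ε i
          - (linearPredictor (fun j (t : unitInterval) => combine ψ (c i j) t)
            (fun j => combine ψ (b₀ j))
            + ∑ a : Fin p × Fin K, c i a.1 a.2 * stackedInner ψ (b - b₀) a)) ^ 2 :=
      Finset.sum_congr rfl fun i _ => by rw [e1, sub_sub]
    rw [e2, Finset.sum_congr rfl fun i _ => congrArg (· ^ 2) (e1 i)]
    linarith only [h3, h4, hP]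
  exact sum_sq_le_of_basic_inequality hn (c := fun i a => c i a.1 a.2) (d := d) (ε := ε)
    (θ := stackedInner ψ (b - b₀)) hc₀ hbasic (hlow _) hdD

theorem setLIntegral_predictionNormSq_fre_le {Ω : Type*} [MeasurableSpace Ω] {μ : Measure Ω}
    [IsProbabilityMeasure μ] {n p K m : ℕ} (hn : 0 < n)
    {X : ℕ → Ω → Fin p → unitInterval → ℝ} {ε : ℕ → Ω → ℝ}
    (hX : ∀ i, Measurable (X i)) (hXc : ∀ i ω j, Continuous (X i ω j))
    (hid : ∀ i, IdentDistrib (X i) (X 0) μ μ) {C : ℝ} (hC : 0 ≤ C)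
    (hXC : ∀ i j, ∀ᵐ ω ∂μ, ∀ t, |X i ω j t| ≤ C)
    {ψ : Fin K → ℝ → ℝ} (hψ : ∀ l, Continuous (ψ l)) {κ : ℝ} (hκ : 0 < κ)
    (hG : ∀ a : Fin K → ℝ, κ * ∑ l, a l ^ 2 ≤ ∫ t : unitInterval, combine ψ a t ^ 2)
    {c : Fin n → Ω → Fin p → Fin K → ℝ} (hcm : ∀ i, Measurable (c i)) {B δ M V : ℝ}
    (hB : ∀ i, ∀ᵐ ω ∂μ, ∑ a : Fin p × Fin K, c i ω a.1 a.2 ^ 2 ≤ B) (hB0 : 0 ≤ B)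
    (hδ : 0 ≤ δ)
    (hc : ∀ (i : Fin n) j, ∀ᵐ ω ∂μ, ∀ a : Fin K → ℝ,
      |∫ t : unitInterval, (combine ψ (c i ω j) t - X i ω j t) * combine ψ a t|
        ≤ δ * √(∫ t : unitInterval, combine ψ a t ^ 2))
    (hM0 : 0 ≤ M)
    (hM : ∀ θ : Fin p × Fin K → ℝ,
      ∑ i, ∫ ω, (∑ a, c i ω a.1 a.2 * θ a) ^ 2 ∂μ ≤ n * M * ∑ a, θ a ^ 2)
    (hε : ∀ i, MemLp (ε i) 2 μ)
    (hind : iIndepFun (fun (i : Fin n) ω =>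
      ((fun a : Fin p × Fin K => c i ω a.1 a.2), ε i ω)) μ)
    (hmean : ∀ (i : Fin n) j l, ∫ ω, c i ω j l * ε i ω ∂μ = 0)
    (hV : ∀ i : Fin n, ∫ ω, ε i ω ^ 2 ∂μ ≤ V)
    {β : Fin p → ℝ → ℝ} (hβ : ∀ j, Continuous fun t : unitInterval => β j t)
    (b₀ : Fin p → Fin K → ℝ) {e S : ℝ}
    (he : ∀ j (t : unitInterval), |combine ψ (b₀ j) t - β j t| ≤ e)
    (hS : ∀ j (t : unitInterval), |combine ψ (b₀ j) t| ≤ S)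
    {lam P : ℝ} (hlam : 0 ≤ lam)
    (hP : lam * ∑ j, ∫ t in (0 : ℝ)..1, (iteratedDeriv m (combine ψ (b₀ j)) t) ^ 2 ≤ P)
    {bhat : Ω → Fin p → Fin K → ℝ}
    (hbhat : ∀ ω, IsFRE ψ m lam (fun i : Fin n => linearPredictor (X i ω) β + ε i ω)
      (fun i => c i ω) (bhat ω))
    {c₀ : ℝ} (hc₀ : 0 < c₀) {E : Set Ω} (hE : MeasurableSet E)
    (hElow : ∀ ω ∈ E, ∀ θ : Fin p × Fin K → ℝ,
      n * c₀ * ∑ a, θ a ^ 2 ≤ ∑ i, (∑ a, c i ω a.1 a.2 * θ a) ^ 2) :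
    ∫⁻ ω in E, ENNReal.ofReal
        (predictionNormSq μ (X 0) fun j t => combine ψ (bhat ω j) t - β j t) ∂μ
      ≤ ENNReal.ofReal (2 * ((2 * M + 2 * p * δ ^ 2 * κ⁻¹) * (2 / c₀ *
          (4 * (p * (C * e) + p * (δ * S)) ^ 2 + 4 / c₀ * (B * V / n) + P / n)))
          + 2 * (p * (C * e)) ^ 2) := by
  have hn' : (0 : ℝ) < n := Nat.cast_pos.2 hn
  set D := p * (C * e) + p * (δ * S) with hD
  set A := 2 * M + 2 * p * δ ^ 2 * κ⁻¹ with hA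
  have hA0 : 0 ≤ A := by positivity
  set R := 2 * (p * (C * e)) ^ 2 with hR
  set N : Ω → ℝ := fun ω => ∑ a : Fin p × Fin K, (∑ i : Fin n, c i ω a.1 a.2 * ε i ω) ^ 2 with hN
  have hcu : ∀ i : Fin n, Measurable fun ω => fun a : Fin p × Fin K => c i ω a.1 a.2 := fun i =>
    measurable_pi_lambda _ fun a =>
      (measurable_pi_apply a.2).comp ((measurable_pi_apply a.1).comp (hcm i))
  obtain ⟨hNint, hNle⟩ := integral_sum_sq_sum_mul_le (μ := μ)
    (c := fun (i : Fin n) ω (a : Fin p × Fin K) => c i ω a.1 a.2) (ε := fun i : Fin n => ε i)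
    hcu (fun i => hε i) hind hB hB0 (fun i a => hmean i a.1 a.2) hV
  rw [Fintype.card_fin] at hNle
  have hcombc : ∀ b : Fin K → ℝ, Continuous fun t : unitInterval => combine ψ b t := fun b =>
    (continuous_combine hψ b).comp continuous_subtype_val
  set h : Ω → ℝ := fun ω =>
    2 * (A * (2 / c₀ * (4 * D ^ 2 + 4 / c₀ * N ω / n ^ 2 + P / n))) + R with hh
  have hpoint : ∀ᵐ ω ∂μ, ω ∈ E →
      predictionNormSq μ (X 0) (fun j t => combine ψ (bhat ω j) t - β j t) ≤ h ω := by
    have hc' : ∀ᵐ ω ∂μ, ∀ (i : Fin n) j, ∀ a : Fin K → ℝ,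
        |∫ t : unitInterval, (combine ψ (c i ω j) t - X i ω j t) * combine ψ a t|
          ≤ δ * √(∫ t : unitInterval, combine ψ a t ^ 2) :=
      ae_all_iff.2 fun i => ae_all_iff.2 fun j => hc i j
    have hX' : ∀ᵐ ω ∂μ, ∀ (i : ℕ) j, ∀ t, |X i ω j t| ≤ C :=
      ae_all_iff.2 fun i => ae_all_iff.2 fun j => hXC i j
    filter_upwards [hc', hX'] with ω hcω hXω hωE
    -- The integral inside `predictionNormSq` has its own variable, so for fixed `ω` the estimate is
    -- a deterministic function.
    have h1 := predictionNormSq_sub_le (μ := μ) (hX 0) (hXc 0) hC (hXC 0)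
      (f := fun j => combine ψ (bhat ω j)) (g := fun j => combine ψ (b₀ j)) (h := β)
      (fun j => hcombc _) (fun j => hcombc _) hβ he
    have h2 : predictionNormSq μ (X 0)
        (fun j t => combine ψ (bhat ω j) t - combine ψ (b₀ j) t)
        ≤ A * ∑ a, stackedInner ψ (bhat ω - b₀) a ^ 2 := by
      have := predictionNormSq_combine_le hn hX hXc hid hC hXC hψ hκ hG hcm hB hc hM (bhat ω - b₀)
      have e1 : (fun j => combine ψ ((bhat ω - b₀) j))
          = fun j t => combine ψ (bhat ω j) t - combine ψ (b₀ j) t := by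
        funext j t
        exact combine_sub ψ (bhat ω j) (b₀ j) t
      rwa [e1] at this
    have h6 := sum_sq_stackedInner_le_of_isFRE hn (x := fun i : Fin n => X i ω)
      (fun i => hXc i ω) hC (fun i => hXω i) hψ hδ hcω hβ b₀ he hS hlam hP (hbhat ω) hc₀
      (hElow ω hωE)
    have h7 := mul_le_mul_of_nonneg_left h6 hA0
    refine h1.trans ?_
    simp only [hh, hR]
    linarith
  have hhint : Integrable h μ :=
    ((((((integrable_const _).add ((hNint.const_mul (4 / c₀)).div_const _)).add
      (integrable_const _)).const_mul _).const_mul _).const_mul _).add (integrable_const _)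
  have hN0 : ∀ ω, 0 ≤ N ω := fun ω => Finset.sum_nonneg fun a _ => sq_nonneg _
  have hP0 : 0 ≤ P := le_trans (mul_nonneg hlam (Finset.sum_nonneg fun j _ =>
    intervalIntegral.integral_nonneg zero_le_one fun t _ => sq_nonneg _)) hP
  have hh0 : ∀ ω, 0 ≤ h ω := fun ω => by
    have := hN0 ω
    simp only [hh, hR]
    positivity
  calc ∫⁻ ω in E, ENNReal.ofReal
        (predictionNormSq μ (X 0) fun j t => combine ψ (bhat ω j) t - β j t) ∂μ
      ≤ ∫⁻ ω in E, ENNReal.ofReal (h ω) ∂μ := by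
        refine setLIntegral_mono_ae' hE ?_
        filter_upwards [hpoint] with ω hω hωE
        exact ENNReal.ofReal_le_ofReal (hω hωE)
    -- `E` was needed only for the pointwise bound. The majorant `h` is integrated over the whole
    -- space, where the unconditional second moment of `Zᵀε` applies.
    _ ≤ ∫⁻ ω, ENNReal.ofReal (h ω) ∂μ := setLIntegral_le_lintegral _ _
    _ = ENNReal.ofReal (∫ ω, h ω ∂μ) :=
        (ofReal_integral_eq_lintegral_ofReal hhint (ae_of_all _ hh0)).symm
    _ ≤ _ := by
        refine ENNReal.ofReal_le_ofReal ?_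
        have e1 : ∀ ω, h ω = 2 * (A * (2 / c₀ * (4 * D ^ 2 + P / n))) + R
            + 2 * (A * (2 / c₀ * (4 / c₀ / n ^ 2))) * N ω := fun ω => by simp only [hh]; ring
        simp only [e1]
        rw [integral_add (integrable_const _) (hNint.const_mul _), integral_const_mul]
        have h8 : 2 * (A * (2 / c₀ * (4 / c₀ / n ^ 2))) * ∫ ω, N ω ∂μ
            ≤ 2 * (A * (2 / c₀ * (4 / c₀ / n ^ 2))) * (n * (B * V)) :=
          mul_le_mul_of_nonneg_left hNle (by positivity)
        have e2 : 2 * (A * (2 / c₀ * (4 / c₀ / n ^ 2))) * (n * (B * V))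
            = 2 * (A * (2 / c₀ * (4 / c₀ * (B * V / n)))) := by
          field_simp
        rw [e2] at h8
        simp only [integral_const, probReal_univ, one_smul]
        linarith

/-! ### Rates -/

/-- With `x = n ^ (1 / (4 s + 1))`, so that `K ≍ x` and `n = x ^ (4 s + 1)`, each claim compares
exponents of `x ≥ 1`. They serve the misfit, the noise, the penalty and the concentration of `ZᵀZ /
n`, respectively. -/
theorem exists_eventually_rates {s : ℝ} {m : ℕ} (hm : 1 ≤ m) (hms : (m : ℝ) ≤ s) {K : ℕ → ℕ}
    (hK0 : ∀ n, 0 < K n)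
    (hK : (fun n => (K n : ℝ)) =Θ[atTop] fun n : ℕ => (n : ℝ) ^ (1 / (4 * s + 1))) :
    ∃ u : ℝ, 0 < u ∧ (∀ᶠ n in atTop,
      ((K n : ℝ) ^ (-s)) ^ 2 ≤ u * (n : ℝ) ^ (-(2 * s) / (4 * s + 1)) ∧
      (((K n : ℝ) ^ (-s)) ^ 2)⁻¹ / n ≤ u * (n : ℝ) ^ (-(2 * s) / (4 * s + 1)) ∧
      ((K n : ℝ) ^ (m + 1)) ^ 2 / n ≤ u) ∧
      Tendsto (fun n => ((((K n : ℝ) ^ (-s)) ^ 2)⁻¹) ^ 2 / n) atTop (nhds 0) := by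
  have hm' : (1 : ℝ) ≤ m := Nat.one_le_cast.2 hm
  have hs1 : 1 ≤ s := hm'.trans hms
  have hs4 : 0 < 4 * s + 1 := by linarith
  set x : ℕ → ℝ := fun n => (n : ℝ) ^ (1 / (4 * s + 1)) with hx
  obtain ⟨A, hA0, hA⟩ := hK.1.exists_pos
  obtain ⟨A', hA'0, hA'⟩ := hK.2.exists_pos
  have key : ∀ᶠ n in atTop, 1 ≤ x n ∧ x n ^ (4 * s + 1) = n ∧
      x n ^ (-(2 * s)) = (n : ℝ) ^ (-(2 * s) / (4 * s + 1)) ∧ (K n : ℝ) ≤ A * x n ∧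
      x n ≤ A' * K n := by
    filter_upwards [hA.bound, hA'.bound, eventually_ge_atTop 1] with n h1 h2 hn
    have hn' : (1 : ℝ) ≤ n := Nat.one_le_cast.2 hn
    have hx1 : 1 ≤ x n := Real.one_le_rpow hn' (by positivity)
    have hx0 : 0 ≤ x n := by linarith
    refine ⟨hx1, ?_, ?_, ?_, ?_⟩
    · rw [hx, ← Real.rpow_mul (by linarith), one_div_mul_cancel hs4.ne', Real.rpow_one]
    · rw [hx, ← Real.rpow_mul (by linarith)]
      congr 1
      ring
    · rwa [Real.norm_of_nonneg (Nat.cast_nonneg _), Real.norm_of_nonneg hx0] at h1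
    · rwa [Real.norm_of_nonneg (Nat.cast_nonneg _), Real.norm_of_nonneg hx0] at h2
  have hsq : ∀ n, ((K n : ℝ) ^ (-s)) ^ 2 = (K n : ℝ) ^ (-(2 * s)) := fun n => by
    rw [← Real.rpow_mul_natCast (Nat.cast_nonneg _)]
    congr 1
    push_cast
    ring
  have hinv : ∀ n, (((K n : ℝ) ^ (-s)) ^ 2)⁻¹ = (K n : ℝ) ^ (2 * s) := fun n => by
    rw [hsq, Real.rpow_neg (Nat.cast_nonneg _), inv_inv]
  refine ⟨A' ^ (2 * s) + A ^ (2 * s) + A ^ (2 * (m + 1)), by positivity, ?_, ?_⟩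
  · filter_upwards [key, eventually_ge_atTop 1] with n ⟨hx1, hxn, hρ, h1, h2⟩ hn
    have hn' : (0 : ℝ) < n := Nat.cast_pos.2 hn
    have hx0 : 0 < x n := by linarith
    have hKn : (0 : ℝ) < K n := Nat.cast_pos.2 (hK0 n)
    have hAs : 0 < A ^ (2 * s) := by positivity
    have hAs' : 0 < A' ^ (2 * s) := by positivity
    have hAm : 0 < A ^ (2 * (m + 1)) := by positivity
    have hxs : 0 < x n ^ (-(2 * s)) := by positivity
    rw [hinv, hsq, ← hρ]
    refine ⟨?_, ?_, ?_⟩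
    · have h3 : (K n : ℝ) ^ (-(2 * s)) ≤ A' ^ (2 * s) * x n ^ (-(2 * s)) := by
        rw [Real.rpow_neg hKn.le, Real.rpow_neg hx0.le, ← div_eq_mul_inv,
          le_div_iff₀ (by positivity), ← div_eq_inv_mul, div_le_iff₀ (by positivity),
          ← Real.mul_rpow hA'0.le hKn.le]
        exact Real.rpow_le_rpow hx0.le h2 (by linarith)
      refine h3.trans (mul_le_mul_of_nonneg_right ?_ hxs.le)
      linarith
    · have h3 : (K n : ℝ) ^ (2 * s) / n ≤ A ^ (2 * s) * x n ^ (-(2 * s)) := by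
        rw [div_le_iff₀ hn', ← hxn, mul_assoc, ← Real.rpow_add hx0]
        calc (K n : ℝ) ^ (2 * s) ≤ (A * x n) ^ (2 * s) :=
              Real.rpow_le_rpow hKn.le h1 (by linarith)
          _ = A ^ (2 * s) * x n ^ (2 * s) := Real.mul_rpow hA0.le hx0.le
          _ ≤ A ^ (2 * s) * x n ^ (-(2 * s) + (4 * s + 1)) := by
              refine mul_le_mul_of_nonneg_left ?_ hAs.le
              exact Real.rpow_le_rpow_of_exponent_le hx1 (by linarith)
      refine h3.trans (mul_le_mul_of_nonneg_right ?_ hxs.le)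
      linarith
    · have h3 : ((K n : ℝ) ^ (m + 1)) ^ 2 / n ≤ A ^ (2 * (m + 1)) := by
        rw [div_le_iff₀ hn', ← pow_mul, mul_comm (m + 1) 2]
        calc (K n : ℝ) ^ (2 * (m + 1)) ≤ (A * x n) ^ (2 * (m + 1)) :=
              pow_le_pow_left₀ hKn.le h1 _
          _ = A ^ (2 * (m + 1)) * x n ^ ((2 * (m + 1) : ℕ) : ℝ) := by
              rw [mul_pow, Real.rpow_natCast]
          _ ≤ A ^ (2 * (m + 1)) * n := by
              refine mul_le_mul_of_nonneg_left ?_ hAm.le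
              rw [← hxn]
              -- The exponent condition is `2 (m + 1) ≤ 4 s + 1`, which follows from `m ≤ s` and `1
              -- ≤ s`.
              refine Real.rpow_le_rpow_of_exponent_le hx1 ?_
              push_cast
              linarith
      linarith
  · have hxtop : Tendsto x atTop atTop :=
      (tendsto_rpow_atTop (by positivity)).comp tendsto_natCast_atTop_atTop
    have hlim : Tendsto (fun n => (A ^ (2 * s)) ^ 2 * (x n)⁻¹) atTop (nhds 0) := by
      simpa using hxtop.inv_tendsto_atTop.const_mul ((A ^ (2 * s)) ^ 2)
    refine squeeze_zero' (Eventually.of_forall fun n => by positivity) ?_ hlim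
    filter_upwards [key, eventually_ge_atTop 1] with n ⟨hx1, hxn, _, h1, h2⟩ hn
    have hn' : (0 : ℝ) < n := Nat.cast_pos.2 hn
    have hx0 : 0 < x n := by linarith
    have hKn : (0 : ℝ) < K n := Nat.cast_pos.2 (hK0 n)
    rw [hinv, div_le_iff₀ hn']
    -- `K ^ (4 s) / n` is of order `1 / x`: the extra `1` in `4 s + 1` is what makes it vanish.
    have e1 : (x n)⁻¹ * (n : ℝ) = (x n ^ (2 * s)) ^ 2 := by
      have : (n : ℝ) = x n ^ (4 * s) * x n := by rw [← hxn, Real.rpow_add_one hx0.ne']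
      rw [this, ← Real.rpow_mul_natCast hx0.le, mul_comm _ (x n), ← mul_assoc,
        inv_mul_cancel₀ hx0.ne', one_mul]
      congr 1
      push_cast
      ring
    rw [mul_assoc, e1, ← mul_pow, ← Real.mul_rpow hA0.le hx0.le]
    exact pow_le_pow_left₀ (by positivity) (Real.rpow_le_rpow hKn.le h1 (by linarith)) 2

/-- Here `Q` stands for `K ^ (-s)`, `W` for `K ^ (m + 1)` and `ρ` for the rate. In the leading
factor the powers of `Q` in `δ² (κ Q²)⁻¹` cancel, so that factor stays bounded; every summand it
multiplies is `O(ρ)`. -/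
theorem risk_bound_le_rate {p C e δ S B V P M κ n c₀ Q ρ u a₃ a₄ Cβ lam W : ℝ}
    (hp : 0 ≤ p) (hC : 0 ≤ C) (hδ : 0 ≤ δ) (hV : 0 ≤ V) (hM : 0 ≤ M) (hκ : 0 < κ) (hn : 0 < n)
    (hc₀ : 0 < c₀) (hQ : 0 < Q) (hQ1 : Q ≤ 1) (hu : 0 ≤ u) (ha₃ : 0 ≤ a₃)
    (hCβ : 0 ≤ Cβ) (hδQ : δ ≤ a₃ * Q) (hlam0 : 0 ≤ lam) (hlam : lam ≤ a₄ * ρ) (he : e = Cβ * Q)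
    (hS : S = Cβ) (hB : B = p * ((κ * Q ^ 2)⁻¹ * (δ + C) ^ 2))
    (hP : P = lam * (p * (Cβ * W) ^ 2)) (h1 : Q ^ 2 ≤ u * ρ) (h2 : (Q ^ 2)⁻¹ / n ≤ u * ρ)
    (h3 : W ^ 2 / n ≤ u) :
    2 * ((2 * M + 2 * p * δ ^ 2 * (κ * Q ^ 2)⁻¹) * (2 / c₀ *
      (4 * (p * (C * e) + p * (δ * S)) ^ 2 + 4 / c₀ * (B * V / n) + P / n)))
      + 2 * (p * (C * e)) ^ 2
    ≤ (2 * ((2 * M + 2 * p * a₃ ^ 2 * κ⁻¹) * (2 / c₀ *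
      (4 * ((p * (C * Cβ) + p * (a₃ * Cβ)) ^ 2 * u)
        + 4 / c₀ * (p * (κ⁻¹ * (a₃ + C) ^ 2) * V * u) + a₄ * (p * Cβ ^ 2) * u)))
      + 2 * (p * (C * Cβ)) ^ 2 * u) * ρ := by
  subst he hS hB hP
  have hκi : 0 < κ⁻¹ := by positivity
  have hδ1 : δ ≤ a₃ := hδQ.trans (mul_le_of_le_one_right ha₃ hQ1)
  have hA : 2 * M + 2 * p * δ ^ 2 * (κ * Q ^ 2)⁻¹ ≤ 2 * M + 2 * p * a₃ ^ 2 * κ⁻¹ := by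
    have e1 : δ ^ 2 * (κ * Q ^ 2)⁻¹ ≤ a₃ ^ 2 * κ⁻¹ := by
      calc δ ^ 2 * (κ * Q ^ 2)⁻¹ ≤ (a₃ * Q) ^ 2 * (κ * Q ^ 2)⁻¹ := by gcongr
        _ = a₃ ^ 2 * κ⁻¹ := by field_simp
    have := mul_le_mul_of_nonneg_left e1 (by positivity : 0 ≤ 2 * p)
    linarith
  have hD : (p * (C * (S * Q)) + p * (δ * S)) ^ 2
      ≤ (p * (C * S) + p * (a₃ * S)) ^ 2 * u * ρ := by
    calc (p * (C * (S * Q)) + p * (δ * S)) ^ 2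
        ≤ (p * (C * (S * Q)) + p * (a₃ * Q * S)) ^ 2 := by gcongr
      _ = (p * (C * S) + p * (a₃ * S)) ^ 2 * Q ^ 2 := by ring
      _ ≤ (p * (C * S) + p * (a₃ * S)) ^ 2 * (u * ρ) := by gcongr
      _ = _ := by ring
  have hBn : p * ((κ * Q ^ 2)⁻¹ * (δ + C) ^ 2) * V / n
      ≤ p * (κ⁻¹ * (a₃ + C) ^ 2) * V * u * ρ := by
    calc p * ((κ * Q ^ 2)⁻¹ * (δ + C) ^ 2) * V / n
        = p * (κ⁻¹ * (δ + C) ^ 2) * V * ((Q ^ 2)⁻¹ / n) := by field_simp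
      _ ≤ p * (κ⁻¹ * (a₃ + C) ^ 2) * V * (u * ρ) := by gcongr
      _ = _ := by ring
  have hPn : lam * (p * (S * W) ^ 2) / n ≤ a₄ * (p * S ^ 2) * u * ρ := by
    calc lam * (p * (S * W) ^ 2) / n = lam * (p * S ^ 2) * (W ^ 2 / n) := by field_simp
      _ ≤ lam * (p * S ^ 2) * u := by gcongr
      _ ≤ a₄ * ρ * (p * S ^ 2) * u := by gcongr
      _ = _ := by ring
  have hlast : (p * (C * (S * Q))) ^ 2 ≤ (p * (C * S)) ^ 2 * u * ρ := by
    calc (p * (C * (S * Q))) ^ 2 = (p * (C * S)) ^ 2 * Q ^ 2 := by ring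
      _ ≤ (p * (C * S)) ^ 2 * (u * ρ) := by gcongr
      _ = _ := by ring
  have hPn0 : 0 ≤ lam * (p * (S * W) ^ 2) / n := by positivity
  calc _ ≤ 2 * ((2 * M + 2 * p * a₃ ^ 2 * κ⁻¹) * (2 / c₀ *
      (4 * ((p * (C * S) + p * (a₃ * S)) ^ 2 * u * ρ)
        + 4 / c₀ * (p * (κ⁻¹ * (a₃ + C) ^ 2) * V * u * ρ) + a₄ * (p * S ^ 2) * u * ρ)))
      + 2 * ((p * (C * S)) ^ 2 * u * ρ) := by gcongr
    _ = _ := by ring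

/-! ### The design -/

theorem designSigma_le {Ω : Type*} [MeasurableSpace Ω] {n p K : ℕ}
    {c : Fin n → Ω → Fin p → Fin K → ℝ} (hc : ∀ i, Measurable (c i)) :
    designSigma c ≤ (inferInstance : MeasurableSpace Ω) := by
  refine Measurable.comap_le (measurable_pi_lambda _ fun i => measurable_pi_lambda _ fun a => ?_)
  exact (measurable_pi_apply a.2).comp ((measurable_pi_apply a.1).comp (hc i))

theorem measurable_designSigma {Ω : Type*} {n p K : ℕ} (c : Fin n → Ω → Fin p → Fin K → ℝ)
    (i : Fin n) (j : Fin p) (l : Fin K) : Measurable[designSigma c] fun ω => c i ω j l := by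
  have h : Measurable fun z : Fin n → Fin p × Fin K → ℝ => z i (j, l) := by fun_prop
  exact h.comp (comap_measurable _)

/-- Stated with quadratic forms, the eigenvalue bound is an intersection of closed conditions on the
matrix, hence closed even though `θ` ranges over an uncountable set. -/
theorem measurableSet_designSigma_lower {Ω : Type*} {n p K : ℕ}
    (c : Fin n → Ω → Fin p → Fin K → ℝ) (c₀ : ℝ) :
    MeasurableSet[designSigma c] {ω | ∀ θ : Fin p × Fin K → ℝ,
      n * c₀ * ∑ a, θ a ^ 2 ≤ ∑ i, (∑ a, c i ω a.1 a.2 * θ a) ^ 2} := by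
  have hcl : IsClosed {z : Fin n → Fin p × Fin K → ℝ | ∀ θ : Fin p × Fin K → ℝ,
      n * c₀ * ∑ a, θ a ^ 2 ≤ ∑ i, (∑ a, z i a * θ a) ^ 2} := by
    rw [Set.ofPred_forall]
    exact isClosed_iInter fun θ => isClosed_le continuous_const (by fun_prop)
  exact ⟨_, hcl.measurableSet, rfl⟩

theorem ae_sum_sq_coeff_le {Ω : Type*} [MeasurableSpace Ω] {μ : Measure Ω} {p K : ℕ}
    {ψ : Fin K → ℝ → ℝ} (hψ : ∀ l, Continuous (ψ l)) {κ : ℝ} (hκ : 0 < κ)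
    (hG : ∀ a : Fin K → ℝ, κ * ∑ l, a l ^ 2 ≤ ∫ t : unitInterval, combine ψ a t ^ 2)
    {x : Ω → Fin p → unitInterval → ℝ} (hx : ∀ ω j, Continuous (x ω j)) {C δ : ℝ} (hδ : 0 ≤ δ)
    (hxC : ∀ j, ∀ᵐ ω ∂μ, ∀ t, |x ω j t| ≤ C) {c : Ω → Fin p → Fin K → ℝ}
    (hc : ∀ j, ∀ᵐ ω ∂μ, ∀ a : Fin K → ℝ,
      |∫ t : unitInterval, (combine ψ (c ω j) t - x ω j t) * combine ψ a t|
        ≤ δ * √(∫ t : unitInterval, combine ψ a t ^ 2)) :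
    ∀ᵐ ω ∂μ, ∑ a : Fin p × Fin K, c ω a.1 a.2 ^ 2 ≤ p * (κ⁻¹ * (δ + C) ^ 2) := by
  filter_upwards [ae_all_iff.2 hxC, ae_all_iff.2 hc] with ω h1 h2
  rw [Fintype.sum_prod_type]
  refine (Finset.sum_le_card_nsmul _ _ (κ⁻¹ * (δ + C) ^ 2) fun j _ => ?_).trans (by simp)
  have h3 := integral_sq_combine_le_of_approx hψ (c ω j) (hx ω j) (h1 j) (h2 j (c ω j))
  rw [abs_of_nonneg hδ] at h3
  rw [← div_eq_inv_mul, le_div_iff₀ hκ, mul_comm]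
  exact (hG _).trans h3

end FunctionalRidge

end

open FunctionalRidge in
/-- Convergence rate of the functional ridge estimator. -/
theorem mainTheorem1
    {Ω : Type*} [MeasurableSpace Ω] (μ : Measure Ω) [IsProbabilityMeasure μ]
    -- number of predictors, smoothness `s = r + ν`, penalty order `m`, spline degree `q`
    (p r m q : ℕ) (ν s : ℝ) (hν : ν ∈ Set.Icc (0 : ℝ) 1) (hs : s = r + ν)
    (hm : 1 ≤ m) (hms : (m : ℝ) ≤ s) (hq : s ≤ q)
    -- coefficient functions
    (β : Fin p → ℝ → ℝ) (hβ : ∀ j, HolderClass r ν (β j))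
    -- predictors `X i ω j` and errors `ε i ω`
    (X : ℕ → Ω → Fin p → unitInterval → ℝ) (ε : ℕ → Ω → ℝ)
    (hXmeas : ∀ i, Measurable (X i))
    (hXcont : ∀ i ω j, Continuous (X i ω j))
    (hXident : ∀ i, IdentDistrib (X i) (X 0) μ μ)
    (C₁ : ℝ) (hXbdd : ∀ i j, ∀ᵐ ω ∂μ, ∀ t, |X i ω j t| ≤ C₁)
    (hεmeas : ∀ i, Measurable (ε i)) (hε4 : ∀ i, MemLp (ε i) 4 μ)
    -- spline spaces of dimension `k n + q` and their bases
    (k : ℕ → ℕ) (hk : ∀ n, 0 < k n)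
    (ψ : (n : ℕ) → Fin (k n + q) → ℝ → ℝ)
    (hψ : ∀ n, Submodule.span ℝ (Set.range (ψ n)) = splineSpace q (k n))
    (κ : ℝ) (hκ : 0 < κ)
    (hGram : ∀ n (a : Fin (k n + q) → ℝ),
      κ * ((k n + q : ℕ) : ℝ) ^ (-(2 * s)) * ∑ l, a l ^ 2
        ≤ ∫ t : unitInterval, (combine (ψ n) a t) ^ 2)
    -- (pre-smoothed) spline coefficients of the predictors; the pre-smoothing error is negligible
    (c : (n : ℕ) → Fin n → Ω → Fin p → Fin (k n + q) → ℝ)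
    (hcmeas : ∀ n i, Measurable (c n i))
    (δ : ℕ → ℝ) (hδ : δ =O[atTop] fun n => ((k n + q : ℕ) : ℝ) ^ (-s))
    (hc : ∀ n (i : Fin n) j, ∀ᵐ ω ∂μ, ∀ f ∈ splineSpace q (k n),
      |∫ t : unitInterval, (combine (ψ n) (c n i ω j) t - X i ω j t) * f t|
        ≤ δ n * Real.sqrt (∫ t : unitInterval, (f t) ^ 2))
    -- independent observations
    (hindep : ∀ n, iIndepFun (fun (i : Fin n) ω => (X i ω, c n i ω, ε i ω)) μ)
    -- error moments given the design matrix
    (σ : ℝ)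
    (hεmean : ∀ n (i : Fin n), μ[ε i | designSigma (c n)] =ᵐ[μ] 0)
    (hεvar : ∀ n (i : Fin n), ∀ᵐ ω ∂μ, condVar (designSigma (c n)) (ε i) μ ω ≤ σ ^ 2)
    -- design matrix stability
    (hdesign : EigenvaluesBoundedInProbability μ fun n ω =>
      (n : ℝ)⁻¹ • ((designMatrix fun i => c n i ω).transpose * designMatrix fun i => c n i ω))
    -- tuning parameters
    (hK : (fun n => ((k n + q : ℕ) : ℝ)) =Θ[atTop] fun n : ℕ => (n : ℝ) ^ (1 / (4 * s + 1)))
    (lam : ℕ → ℝ) (hlam : ∀ n, 0 < lam n)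
    (hlamrate : lam =Θ[atTop] fun n : ℕ => (n : ℝ) ^ (-(2 * s) / (4 * s + 1)))
    -- the estimator
    (bhat : (n : ℕ) → Ω → Fin p → Fin (k n + q) → ℝ)
    (hbmeas : ∀ n, Measurable (bhat n))
    (hbhat : ∀ n ω, IsFRE (ψ n) m (lam n)
      (fun i : Fin n => linearPredictor (X i ω) β + ε i ω) (fun i => c n i ω) (bhat n ω)) :
    IsBigOP μ
      (fun n => condLExp (designSigma (c n)) μ fun ω =>
        ENNReal.ofReal (predictionNormSq μ (X 0) fun j t => combine (ψ n) (bhat n ω j) t - β j t))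
      (fun n : ℕ => (n : ℝ) ^ (-(2 * s) / (4 * s + 1))) := by
  have hm' : (1 : ℝ) ≤ m := Nat.one_le_cast.2 hm
  have hs0 : 0 < s := by linarith
  have hmq : m ≤ q := by exact_mod_cast hms.trans hq
  have hq1 : 1 ≤ q := hm.trans hmq
  have hspline : ∀ n (a : Fin (k n + q) → ℝ), combine (ψ n) a ∈ splineSpace q (k n) :=
    fun n a => hψ n ▸ combine_mem_span (ψ n) a
  have hψc : ∀ n l, Continuous (ψ n l) := fun n l =>
    continuous_of_mem_splineSpace hq1 (hψ n ▸ Submodule.subset_span (Set.mem_range_self l))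
  have hβc : ∀ j, Continuous fun t : unitInterval => β j t := fun j =>
    continuousOn_iff_continuous_domRestrict.1 (hβ j).continuousOn
  have hε2 : ∀ i, MemLp (ε i) 2 μ := fun i => (hε4 i).mono_exponent (by norm_num)
  set C := |C₁| with hC
  have hXC : ∀ i j, ∀ᵐ ω ∂μ, ∀ t, |X i ω j t| ≤ C := fun i j =>
    (hXbdd i j).mono fun ω hω t => (hω t).trans (le_abs_self _)
  -- approximation of the coefficient functions
  choose Cj hCj0 hCj using fun j => exists_mem_splineSpace_approx hq1 hmq hν (hs ▸ hq) (hβ j)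
  set Cβ := ∑ j, Cj j with hCβ
  have hCβ0 : 0 ≤ Cβ := Finset.sum_nonneg fun j _ => hCj0 j
  have hCjle : ∀ j, Cj j ≤ Cβ := fun j =>
    Finset.single_le_sum (fun j _ => hCj0 j) (Finset.mem_univ j)
  set K : ℕ → ℕ := fun n => k n + q with hKdef
  have hK0 : ∀ n, 0 < K n := fun n => Nat.add_pos_left (hk n) q
  have hK1 : ∀ n, (1 : ℝ) ≤ K n := fun n => Nat.one_le_cast.2 (hK0 n)
  set Q : ℕ → ℝ := fun n => (K n : ℝ) ^ (-s) with hQdef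
  have hQ0 : ∀ n, 0 < Q n := fun n => Real.rpow_pos_of_pos (Nat.cast_pos.2 (hK0 n)) _
  have hQ1 : ∀ n, Q n ≤ 1 := fun n => Real.rpow_le_one_of_one_le_of_nonpos (hK1 n) (by linarith)
  have hb₀ : ∀ n j, ∃ b : Fin (k n + q) → ℝ,
      (∀ t : unitInterval, |combine (ψ n) b t - β j t| ≤ Cβ * Q n) ∧
      (∀ t : unitInterval, |combine (ψ n) b t| ≤ Cβ) ∧
      ∫ t in (0 : ℝ)..1, (iteratedDeriv m (combine (ψ n) b) t) ^ 2
        ≤ (Cβ * (K n : ℝ) ^ (m + 1)) ^ 2 := by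
    intro n j
    obtain ⟨g, hg, h1, h2, h3⟩ := hCj j (k n) (hk n)
    obtain ⟨b, rfl⟩ := exists_combine_eq (ψ := ψ n) (hψ n ▸ hg)
    rw [← hs] at h1
    refine ⟨b, fun t => (h1 t t.2).trans (mul_le_mul_of_nonneg_right (hCjle j) (hQ0 n).le),
      fun t => (h2 t t.2).trans (hCjle j), h3.trans ?_⟩
    have := hCj0 j
    have := hCjle j
    gcongr
  choose b₀ hb₀e hb₀S hb₀P using hb₀
  -- rates
  obtain ⟨u, hu0, hrates, hlim⟩ := exists_eventually_rates hm hms hK0 hK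
  obtain ⟨a₃, ha₃0, ha₃⟩ := hδ.exists_pos
  obtain ⟨a₄, ha₄0, ha₄⟩ := hlamrate.1.exists_pos
  set ρ : ℕ → ℝ := fun n => (n : ℝ) ^ (-(2 * s) / (4 * s + 1)) with hρdef
  have hδle : ∀ᶠ n in atTop, |δ n| ≤ a₃ * Q n := by
    filter_upwards [ha₃.bound] with n h
    rwa [Real.norm_of_nonneg (hQ0 n).le] at h
  have hlamle : ∀ᶠ n in atTop, lam n ≤ a₄ * ρ n := by
    filter_upwards [ha₄.bound] with n h
    rw [Real.norm_of_nonneg (hlam n).le, Real.norm_of_nonneg (by positivity)] at h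
    exact h
  -- the Gram matrix and the coefficients
  have hκn : ∀ n, 0 < κ * Q n ^ 2 := fun n => mul_pos hκ (pow_pos (hQ0 n) 2)
  have hQsq : ∀ n, (K n : ℝ) ^ (-(2 * s)) = Q n ^ 2 := fun n => by
    rw [hQdef, ← Real.rpow_mul_natCast (Nat.cast_nonneg _)]
    congr 1
    push_cast
    ring
  have hG : ∀ n (a : Fin (k n + q) → ℝ),
      κ * Q n ^ 2 * ∑ l, a l ^ 2 ≤ ∫ t : unitInterval, combine (ψ n) a t ^ 2 := fun n a => by
    rw [← hQsq]
    exact hGram n a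
  have hc' : ∀ n (i : Fin n) j, ∀ᵐ ω ∂μ, ∀ a : Fin (k n + q) → ℝ,
      |∫ t : unitInterval, (combine (ψ n) (c n i ω j) t - X i ω j t) * combine (ψ n) a t|
        ≤ |δ n| * √(∫ t : unitInterval, combine (ψ n) a t ^ 2) := by
    intro n i j
    filter_upwards [hc n i j] with ω hω a
    exact (hω _ (hspline n a)).trans
      (mul_le_mul_of_nonneg_right (le_abs_self _) (Real.sqrt_nonneg _))
  set B : ℕ → ℝ := fun n => p * ((κ * Q n ^ 2)⁻¹ * (|δ n| + C) ^ 2) with hBdef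
  have hB0 : ∀ n, 0 ≤ B n := fun n => by
    have := hκn n
    positivity
  have hB : ∀ n (i : Fin n), ∀ᵐ ω ∂μ,
      ∑ a : Fin p × Fin (k n + q), c n i ω a.1 a.2 ^ 2 ≤ B n := fun n i =>
    ae_sum_sq_coeff_le (hψc n) (hκn n) (hG n) (hXcont i) (abs_nonneg _) (hXC i) (hc' n i)
  -- `B n` is of order `K ^ (2 s)`, so this is the limit `K ^ (4 s) / n → 0`.
  have hBlim : ∀ᶠ n in atTop, B n ^ 2 / n < 1 / 2 := by
    have hlim' := hlim.const_mul ((p * (κ⁻¹ * (a₃ + C) ^ 2)) ^ 2)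
    rw [mul_zero] at hlim'
    filter_upwards [hlim'.eventually (gt_mem_nhds (by norm_num : (0 : ℝ) < 1 / 2)), hδle]
      with n h1 h2
    refine lt_of_le_of_lt ?_ h1
    have h3 : |δ n| ≤ a₃ := h2.trans (mul_le_of_le_one_right ha₃0.le (hQ1 n))
    have h4 : B n ≤ p * (κ⁻¹ * (a₃ + C) ^ 2) * (Q n ^ 2)⁻¹ := by
      have := hQ0 n
      calc B n ≤ p * ((κ * Q n ^ 2)⁻¹ * (a₃ + C) ^ 2) := by
            simp only [hBdef]
            gcongr
        _ = _ := by rw [mul_inv]; ring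
    calc B n ^ 2 / n ≤ (p * (κ⁻¹ * (a₃ + C) ^ 2) * (Q n ^ 2)⁻¹) ^ 2 / n := by
          have := hB0 n
          gcongr
      _ = _ := by rw [mul_pow]; ring
  -- mean second moments of the coefficients
  have hcu : ∀ n (i : Fin n),
      Measurable fun ω => fun a : Fin p × Fin (k n + q) => c n i ω a.1 a.2 := fun n i =>
    measurable_pi_lambda _ fun a =>
      (measurable_pi_apply a.2).comp ((measurable_pi_apply a.1).comp (hcmeas n i))
  have hind : ∀ n, iIndepFun (fun (i : Fin n) ω =>
      ((fun a : Fin p × Fin (k n + q) => c n i ω a.1 a.2), ε i ω)) μ := by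
    intro n
    have hmeas : Measurable fun y : (Fin p → unitInterval → ℝ) ×
        (Fin p → Fin (k n + q) → ℝ) × ℝ =>
        ((fun a : Fin p × Fin (k n + q) => y.2.1 a.1 a.2), y.2.2) := by
      refine Measurable.prodMk (measurable_pi_lambda _ fun a => ?_)
        (measurable_snd.comp measurable_snd)
      exact (measurable_pi_apply a.2).comp ((measurable_pi_apply a.1).comp
        (measurable_fst.comp measurable_snd))
    exact (hindep n).comp _ fun _ => hmeas
  -- Only the upper eigenvalue bound is used here, at the fixed level `1/2`, so `M` does not depend
  -- on `η`.
  obtain ⟨c₁, M₁, -, hM₁⟩ := hdesign (1 / 2) (by norm_num)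
  set M := |M₁| + 1 with hMdef
  have hM : ∀ᶠ n in atTop, ∀ θ : Fin p × Fin (k n + q) → ℝ,
      ∑ i : Fin n, ∫ ω, (∑ a, c n i ω a.1 a.2 * θ a) ^ 2 ∂μ ≤ n * M * ∑ a, θ a ^ 2 := by
    filter_upwards [hM₁, hBlim, eventually_gt_atTop 0] with n h1 h2 hn θ
    have hindc : iIndepFun (fun (i : Fin n) ω =>
        (fun a : Fin p × Fin (k n + q) => c n i ω a.1 a.2)) μ :=
      (hind n).comp (fun _ => Prod.fst) fun _ => measurable_fst
    refine sum_integral_sq_le_of_measure_le_half hn (hcu n) hindc (hB n) h2 ?_ θ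
    refine (measure_mono ?_).trans (h1.trans_eq ?_)
    · intro ω hω h
      refine hω fun θ => (sum_sq_bounds_of_spectrum hn h θ).2.trans ?_
      have := le_abs_self M₁
      gcongr
    · rw [ENNReal.ofReal_div_of_pos (by norm_num)]
      simp
  have hm₀ : ∀ n, designSigma (c n) ≤ (inferInstance : MeasurableSpace Ω) := fun n =>
    designSigma_le (hcmeas n)
  have hmean : ∀ n (i : Fin n) j l, ∫ ω, c n i ω j l * ε i ω ∂μ = 0 := by
    intro n i j l
    refine integral_mul_eq_zero_of_condExp (hm₀ n)
      (measurable_designSigma (c n) i j l).stronglyMeasurable (B := √(B n)) ?_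
      ((hε2 i).integrable one_le_two) (hεmean n i)
    filter_upwards [hB n i] with ω hω
    refine Real.abs_le_sqrt (le_trans ?_ hω)
    exact Finset.single_le_sum (f := fun a : Fin p × Fin (k n + q) => c n i ω a.1 a.2 ^ 2)
      (fun a _ => sq_nonneg _) (Finset.mem_univ (j, l))
  have hV : ∀ n (i : Fin n), ∫ ω, ε i ω ^ 2 ∂μ ≤ σ ^ 2 := fun n i =>
    integral_sq_le_of_condVar_le (hm₀ n) (hε2 i) (hεmean n i) (hεvar n i)
  -- conclusion
  intro η hη
  obtain ⟨c₀, C₀, hc₀, hdes⟩ := hdesign (η / 2) (by positivity)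
  set L := 2 * ((2 * M + 2 * p * a₃ ^ 2 * κ⁻¹) * (2 / c₀ *
      (4 * ((p * (C * Cβ) + p * (a₃ * Cβ)) ^ 2 * u)
        + 4 / c₀ * (p * (κ⁻¹ * (a₃ + C) ^ 2) * σ ^ 2 * u) + a₄ * (p * Cβ ^ 2) * u)))
      + 2 * (p * (C * Cβ)) ^ 2 * u with hL
  have hL0 : 0 ≤ L := by positivity
  -- Markov's inequality then gives probability `L / (L + 1) * (η / 2)` on `G`, and the complement
  -- of `G` has the other `η / 2`. The `+ 1` keeps the threshold positive when `L = 0`.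
  refine ⟨(L + 1) / (η / 2), div_pos (by linarith) (half_pos hη), ?_⟩
  filter_upwards [hdes, hM, hrates, hδle, hlamle, eventually_gt_atTop 0]
    with n hdn hMn ⟨hr1, hr2, hr3⟩ hδn hlamn hn
  have hn' : (0 : ℝ) < n := Nat.cast_pos.2 hn
  have hρ : 0 < ρ n := Real.rpow_pos_of_pos hn' _
  set G : Set Ω := {ω | ∀ θ : Fin p × Fin (k n + q) → ℝ,
    n * c₀ * ∑ a, θ a ^ 2 ≤ ∑ i, (∑ a, c n i ω a.1 a.2 * θ a) ^ 2} with hGdef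
  have hGm : MeasurableSet[designSigma (c n)] G := measurableSet_designSigma_lower (c n) c₀
  have hGc : μ Gᶜ ≤ ENNReal.ofReal (η / 2) := by
    refine (measure_mono ?_).trans hdn
    intro ω hω h
    exact hω fun θ => (sum_sq_bounds_of_spectrum hn h θ).1
  have hPn : lam n * ∑ j, ∫ t in (0 : ℝ)..1, (iteratedDeriv m (combine (ψ n) (b₀ n j)) t) ^ 2
      ≤ lam n * (p * (Cβ * (K n : ℝ) ^ (m + 1)) ^ 2) := by
    refine mul_le_mul_of_nonneg_left ?_ (hlam n).le
    exact (Finset.sum_le_card_nsmul _ _ _ fun j _ => hb₀P n j).trans (by simp)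
  have hrisk := setLIntegral_predictionNormSq_fre_le hn hXmeas hXcont hXident (abs_nonneg C₁) hXC
    (hψc n) (hκn n) (hG n) (hcmeas n) (hB n) (hB0 n) (abs_nonneg (δ n)) (hc' n)
    (by positivity : 0 ≤ M) hMn hε2 (hind n) (hmean n) (hV n) hβc (b₀ n) (hb₀e n) (hb₀S n)
    (hlam n).le hPn (hbhat n) hc₀ (hm₀ n _ hGm) fun ω hω => hω
  have hbound := risk_bound_le_rate (p := p) (C := C) (V := σ ^ 2) (M := M) (κ := κ) (n := n)
    (W := (K n : ℝ) ^ (m + 1)) (Nat.cast_nonneg p) (abs_nonneg C₁) (abs_nonneg (δ n)) (sq_nonneg σ)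
    (by positivity) hκ hn' hc₀ (hQ0 n) (hQ1 n) hu0.le ha₃0.le hCβ0 hδn (hlam n).le hlamn
    rfl rfl rfl rfl hr1 hr2 hr3
  have hF := hrisk.trans (ENNReal.ofReal_le_ofReal hbound)
  have ht : 0 < (L + 1) / (η / 2) * ρ n :=
    mul_pos (div_pos (by linarith) (half_pos hη)) hρ
  have hcond := measure_condLExp_gt_inter_le (hm₀ n) μ _ hGm ht hF
  refine (measure_mono (fun ω hω => ?_)).trans ((measure_union_le _ Gᶜ).trans
    ((add_le_add hcond hGc).trans ?_))
  · by_cases hωG : ω ∈ G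
    · exact Or.inl ⟨hω, hωG⟩
    · exact Or.inr hωG
  · rw [← ENNReal.ofReal_add (div_nonneg (mul_nonneg hL0 hρ.le) ht.le) (half_pos hη).le]
    refine ENNReal.ofReal_le_ofReal ?_
    have h1 : L * ρ n / ((L + 1) / (η / 2) * ρ n) ≤ η / 2 := by
      rw [div_le_iff₀ ht]
      have : η / 2 * ((L + 1) / (η / 2) * ρ n) = (L + 1) * ρ n := by
        rw [← mul_assoc, mul_div_cancel₀ _ (half_pos hη).ne']
      rw [this]
      exact mul_le_mul_of_nonneg_right (by linarith) hρ.le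
    linarith only [h1]
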